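/- All graphs are finite and simple (no loops). For graphs $G,H$, a multi-homomorphism $G\to H$ is a map $\phi\colon V(G)\to\mathcal P(V(H))\setminus\{\emptyset\}$ such that every $f\colon V(G)\to V(H)$ with $f(v)\in\phi(v)$ for all $v$ is a graph homomorphism; $\mathrm{Hom}(G,H)$ is the subcomplex of $\prod_{v\in V(G)}\Delta^{V(H)}$ (products of full simplices on the vertex set $V(H)$) consisting of the cells $\prod_v\Delta^{\phi(v)}$ for all multi-homomorphisms $\phi$. A $\mathbb Z_2$-action on a graph $G$ is given by a graph homomorphism $\alpha\colon G\to G$ with $\alpha^2=\mathrm{id}$; it flips an edge if there is an edge $\{u,v\}$ of $G$ with $\alpha(u)=v$ and $\alpha(v)=u$. The action $\alpha$ on $G$ acts on $\mathrm{Hom}(G,H)$ by $(\alpha * x)(v)=x(\alpha(v))$, and an action $\beta$ on $H$ acts on $\mathrm{Hom}(G,H)$ by letting $(x*\beta)(v)$ be the image of the point $x(v)$ under the affine extension of $\beta$. Let $G$ and $G'$ be graphs with $\mathbb Z_2$-actions $\alpha$ and $\beta$. Put $\mathrm{Hom}_{\mathbb Z_2}(G,G')=\{x\in\mathrm{Hom}(G,G')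 : \alpha*x=x*\beta\}$, and let $G'^{\mathbb Z_2}$ be the graph whose vertices are the orbits $\{u,\beta(u)\}$, $u\in V(G')$, and whose edges are the pairs $\{\{u,\beta(u)\},\{v,\beta(v)\}\}$ such that $\{u,v\}$ and $\{u,\beta(v)\}$ are edges of $G'$. For a space $X$ with a fixed point free involution, $\mathrm{coind}\,X$ is the largest $j$ such that there is a $\mathbb Z_2$-map $S^j\to X$ ($S^j$ with the antipodal action), and $\mathrm{hind}\,X$ is the largest $j$ such that $\bar f^*(\gamma^j)\neq0$ in $H^j(X/\mathbb Z_2;\mathbb Z_2)$, where $f\colon X\to S^\infty$ is a $\mathbb Z_2$-map, $\bar f\colon X/\mathbb Z_2\to\mathbb{RP}^\infty$ is the induced map, and $H^*(\mathbb{RP}^\infty;\mathbb Z_2)=\mathbb Z_2[\gamma]$. A space $X$ is $m$-connected if for all $-1\le j\le m$ every continuous map $S^j\to X$ extends to a continuous map $D^{j+1}\to X$. **Theorem.** Suppose that the action $\alpha$ on $G$ flips an edge, and let $k\ge1$. If * $\mathrm{coind}\,\mathrm{Hom}(G,G'^{\mathbb Z_2})\ge k-1$ (with the action induced by $\alpha$),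 * $\mathrm{Hom}_{\mathbb Z_2}(G,G')\ne\emptyset$, and * $\mathrm{Hom}(G,G')$ is $(k-1)$-connected, then $$\mathrm{hind}\,\mathrm{Hom}(G',H)+k\le\mathrm{hind}\,\mathrm{Hom}(G,H)$$ for every graph $H$ with $\mathrm{Hom}(G',H)\ne\emptyset$, where $\mathrm{Hom}(G',H)$ and $\mathrm{Hom}(G,H)$ carry the actions induced by $\beta$ and $\alpha$. (The action on $\mathrm{Hom}(G',H)$ is free, since the second condition forces $\beta$ to flip an edge.) -/

import Mathlib

namespace HomIndex

/-! ## Spaces with a `ℤ/2`-action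

A `ℤ/2`-action on a space `X` is given by the map `τ : X → X` by which the generator acts
(a continuous involution). -/

/-- `f` is a `ℤ/2`-map from `(X, τ)` to `(Y, σ)` -/
def IsZ2Map {X Y : Type*} [TopologicalSpace X] [TopologicalSpace Y]
    (τ : X → X) (σ : Y → Y) (f : C(X, Y)) : Prop :=
  ∀ x, f (τ x) = σ (f x)

/-- The orbit space `X/ℤ₂`, with the quotient topology. -/
abbrev OrbitSpace {X : Type*} (τ : X → X) : Type _ := Quot (fun x y : X => y = τ x)

/-- The map `X/ℤ₂ → Y/ℤ₂` induced by a `ℤ/2`-map `X → Y`. -/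
def orbitMap {X Y : Type*} [TopologicalSpace X] [TopologicalSpace Y]
    {τ : X → X} {σ : Y → Y} (f : C(X, Y)) (hf : IsZ2Map τ σ f) :
    C(OrbitSpace τ, OrbitSpace σ) where
  toFun := Quot.map f (fun x y h => by rw [h]; exact hf x)
  continuous_toFun := by
    refine continuous_quot_lift _ ?_
    exact continuous_quot_mk.comp f.continuous

/-- The sphere `S^k`, as the unit sphere of Euclidean `(k+1)`-space. -/
abbrev Sph (k : ℕ) : Type := Metric.sphere (0 : EuclideanSpace ℝ (Fin (k + 1))) 1

/-- The antipodal map on `S^k`. -/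
noncomputable def antipode (k : ℕ) : Sph k → Sph k := fun x => -x

/-- The coindex of `(X, τ)`: the largest `k` such that there is a `ℤ/2`-map `S^k → X`
(`⊥` if there is none, that is, if `X` is empty). -/
noncomputable def coind {X : Type*} [TopologicalSpace X] (τ : X → X) : WithBot ℕ∞ :=
  sSup {m | ∃ k : ℕ, m = ((k : ℕ∞) : WithBot ℕ∞) ∧
    ∃ f : C(Sph k, X), IsZ2Map (antipode k) τ f}

/-- `X` is `m`-connected: for `-1 ≤ j ≤ m`, every continuous map `S^j → X` extends to the disk
`D^(j+1)`. Here `n = j + 1`; for `n = 0` the sphere is empty and the disk is a point. -/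
def IsConn (X : Type*) [TopologicalSpace X] (m : ℤ) : Prop :=
  ∀ n : ℕ, (n : ℤ) ≤ m + 1 →
    ∀ f : C(Metric.sphere (0 : EuclideanSpace ℝ (Fin n)) 1, X),
      ∃ g : C(Metric.closedBall (0 : EuclideanSpace ℝ (Fin n)) 1, X),
        ∀ x : Metric.sphere (0 : EuclideanSpace ℝ (Fin n)) 1,
          g ⟨x, Metric.sphere_subset_closedBall x.2⟩ = f x

/-! ## The infinite sphere and infinite projective space -/

/-- `S^∞ = ⋃ₙ S^n`: the unit vectors among the finitely supported real sequences. -/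
def InfSph : Type :=
  {x : ℕ → ℝ // ∃ n : ℕ, (∀ i, n < i → x i = 0) ∧ ∑ i ∈ Finset.range (n + 1), x i ^ 2 = 1}

/-- The inclusion `S^n → S^∞`. -/
def InfSph.incl (n : ℕ) (x : Sph n) : InfSph :=
  ⟨fun i => if h : i < n + 1 then x.1 ⟨i, h⟩ else 0, n,
    fun i hi => dif_neg (by omega), by
      have h : ‖x.1‖ = 1 := by simp
      have h2 : ∑ i, x.1 i ^ 2 = 1 := by
        have := EuclideanSpace.real_norm_sq_eq x.1
        rw [h] at this
        linarith
      rw [Finset.sum_range]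
      refine (Finset.sum_congr rfl (fun i _ => ?_)).trans h2
      simp only [dif_pos i.2, Fin.eta]⟩

/-- `S^∞` carries the colimit (weak) topology: a set is open iff its preimage in every `S^n`
is open. -/
instance : TopologicalSpace InfSph :=
  ⨆ n, TopologicalSpace.coinduced (InfSph.incl n) inferInstance

/-- The antipodal map on `S^∞`. -/
def InfSph.antipode (x : InfSph) : InfSph :=
  ⟨fun i => -x.1 i, by
    obtain ⟨n, h0, h1⟩ := x.2
    exact ⟨n, fun i hi => by simp [h0 i hi], by simpa using h1⟩⟩

/-- `ℝP^∞ = S^∞/ℤ₂`. -/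
abbrev InfProj : Type := OrbitSpace InfSph.antipode

/-! ## Singular cohomology with coefficients in `ℤ/2` -/

/-- Singular `n`-simplices of `X`. -/
abbrev SingSimplex (X : Type*) [TopologicalSpace X] (n : ℕ) : Type _ :=
  C(stdSimplex ℝ (Fin (n + 1)), X)

/-- The singular `m`-simplex obtained from the `n`-simplex `s` through the affine map of standard
simplices which is given by `a` on the vertices. -/
noncomputable def SingSimplex.restrict {X : Type*} [TopologicalSpace X] {m n : ℕ}
    (s : SingSimplex X n) (a : Fin (m + 1) → Fin (n + 1)) : SingSimplex X m :=
  s.comp ⟨stdSimplex.map a, stdSimplex.continuous_map a⟩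

/-- Singular `n`-cochains with coefficients in `ℤ/2`. -/
abbrev Cochain (X : Type*) [TopologicalSpace X] (n : ℕ) : Type _ := SingSimplex X n → ZMod 2

/-- The coboundary operator (there are no signs modulo 2). -/
noncomputable def coboundary {X : Type*} [TopologicalSpace X] {n : ℕ} (c : Cochain X n) :
    Cochain X (n + 1) :=
  fun s => ∑ i : Fin (n + 2), c (s.restrict i.succAbove)

/-- `c` is a cocycle -/
def IsCocycle {X : Type*} [TopologicalSpace X] {n : ℕ} (c : Cochain X n) : Prop :=
  coboundary c = 0

/-- `c` is a coboundary, that is, the class of `c` vanishes in `H^n(X; ℤ/2)`. In degree `0` only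
the zero cochain is a coboundary. -/
def IsCoboundary {X : Type*} [TopologicalSpace X] : {n : ℕ} → Cochain X n → Prop
  | 0, c => c = 0
  | n + 1, c => ∃ b : Cochain X n, coboundary b = c

/-- The pullback `f^#` of cochains. -/
def Cochain.pullback {X Y : Type*} [TopologicalSpace X] [TopologicalSpace Y] {n : ℕ}
    (f : C(X, Y)) (c : Cochain Y n) : Cochain X n :=
  fun s => c (f.comp s)

/-- The cup product of cochains: the first factor is evaluated on the front `p`-face and the second
one on the back `q`-face. -/
noncomputable def cup {X : Type*} [TopologicalSpace X] {p q : ℕ} (a : Cochain X p)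
    (b : Cochain X q) : Cochain X (p + q) :=
  fun s => a (s.restrict (Fin.castLE (by omega))) *
    b (s.restrict (m := q) (n := p + q) (Fin.natAdd p))

/-- The `k`-th cup power of a `1`-cochain. For a cocycle `c` it represents the `k`-th power of the
class of `c` in the cohomology ring. -/
noncomputable def cupPow {X : Type*} [TopologicalSpace X] (c : Cochain X 1) :
    (k : ℕ) → Cochain X k
  | 0 => fun _ => 1
  | k + 1 => cup (cupPow c k) c

/-- The `1`-cochain `c` on `ℝP^∞` is a cocycle that represents the generator `γ`, the nonzero
element of `H^1(ℝP^∞; ℤ/2)`, for which `H^*(ℝP^∞; ℤ/2) = ℤ/2[γ]`. -/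
def RepresentsGamma (c : Cochain InfProj 1) : Prop := IsCocycle c ∧ ¬ IsCoboundary c

/-- The cohomological index of `(X, τ)`: the largest `k` with `f̄^*(γ^k) ≠ 0` in
`H^k(X/ℤ₂; ℤ/2)`, where `f : X → S^∞` is a `ℤ/2`-map and `f̄ : X/ℤ₂ → ℝP^∞` is the induced map
(`⊥` if there is no such `k`, that is, if `X` is empty). -/
noncomputable def hind {X : Type*} [TopologicalSpace X] (τ : X → X) : WithBot ℕ∞ :=
  sSup {m | ∃ k : ℕ, m = ((k : ℕ∞) : WithBot ℕ∞) ∧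
    ∃ (f : C(X, InfSph)) (hf : IsZ2Map τ InfSph.antipode f) (c : Cochain InfProj 1),
      RepresentsGamma c ∧ ¬ IsCoboundary (Cochain.pullback (orbitMap f hf) (cupPow c k))}

/-! ## Graphs and `Hom`-complexes -/

/-- A multi-homomorphism from `G` to `H`: nonempty sets of vertices of `H`, indexed by the vertices
of `G`, such that every selection from them is a graph homomorphism. -/
def IsMultiHom {V W : Type*} (G : SimpleGraph V) (H : SimpleGraph W) (φ : V → Set W) : Prop :=
  (∀ v, (φ v).Nonempty) ∧
    ∀ f : V → W, (∀ v, f v ∈ φ v) → ∀ u u', G.Adj u u' → H.Adj (f u) (f u')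

/-- The vertices which have a nonzero coordinate at a point of a product of simplices, that is, the
cell whose relative interior contains the point. -/
def carrier {V W : Type*} [Fintype W] (x : V → stdSimplex ℝ W) : V → Set W :=
  fun v => {w | x v w ≠ 0}

/-- The underlying space of `Hom(G, H)`: the union of those cells of the product, over the vertices
of `G`, of simplices spanned by the vertices of `H` which are indexed by multi-homomorphisms. -/
abbrev HomComplex {V W : Type*} [Fintype W] (G : SimpleGraph V) (H : SimpleGraph W) : Type _ :=
  {x : V → stdSimplex ℝ W // IsMultiHom G H (carrier x)}

/-- A `ℤ/2`-action on a graph, given by a graph homomorphism whose square is the identity. -/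
structure GraphInvolution {V : Type*} (G : SimpleGraph V) where
  toHom : G →g G
  invol : ∀ v, toHom (toHom v) = v

/-- The involution flips an edge: some edge is invariant, but not fixed pointwise. -/
def GraphInvolution.FlipsEdge {V : Type*} {G : SimpleGraph V} (α : GraphInvolution G) : Prop :=
  ∃ u v, G.Adj u v ∧ α.toHom u = v ∧ α.toHom v = u

/-- Precomposition `Hom(G', H) → Hom(G, H)`, `x ↦ a ∗ x`, with a graph homomorphism
`a : G → G'`. -/
def HomComplex.precomp {V V' W : Type*} [Fintype W] {G : SimpleGraph V} {G' : SimpleGraph V'}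
    {H : SimpleGraph W} (a : G →g G') (x : HomComplex G' H) : HomComplex G H :=
  ⟨fun v => x.1 (a v), fun v => x.2.1 (a v), by
    classical
    intro f hf u u' huu'
    choose g hg using x.2.1
    have hne : a u' ≠ a u := (a.map_adj huu').ne'
    have := x.2.2 (fun z => if z = a u then f u else if z = a u' then f u' else g z)
      (fun z => by
        by_cases h1 : z = a u
        · rw [h1, if_pos rfl]; exact hf u
        · by_cases h2 : z = a u'
          · rw [h2, if_neg hne, if_pos rfl]; exact hf u'
          · simpa [h1, h2] using hg z) (a u) (a u') (a.map_adj huu')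
    simpa [hne] using this⟩

/-- Postcomposition `Hom(G, G') → Hom(G, G'')`, `x ↦ x ∗ b`, with a graph homomorphism
`b : G' → G''`: every coordinate `x v` is mapped by the affine extension of `b`. -/
noncomputable def HomComplex.postcomp {V W W' : Type*} [Fintype W] [Fintype W']
    {G : SimpleGraph V} {H : SimpleGraph W} {H' : SimpleGraph W'}
    (b : H →g H') (x : HomComplex G H) : HomComplex G H' :=
  ⟨fun v => stdSimplex.map b (x.1 v), by
    have key : ∀ (v : V) (w' : W'), stdSimplex.map b (x.1 v) w' ≠ 0 →
        ∃ w, x.1 v w ≠ 0 ∧ b w = w' := by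
      classical
      intro v w' h
      rw [stdSimplex.map_coe, FunOnFinite.linearMap_apply_apply] at h
      obtain ⟨w, hw, hne⟩ := Finset.exists_ne_zero_of_sum_ne_zero h
      exact ⟨w, hne, by simpa using hw⟩
    refine ⟨fun v => ?_, fun f hf u u' huu' => ?_⟩
    · by_contra hcon
      have h0 : ∀ w', stdSimplex.map b (x.1 v) w' = 0 := by
        intro w'
        by_contra h
        exact hcon ⟨w', h⟩
      have h1 := stdSimplex.sum_eq_one (stdSimplex.map b (x.1 v))
      simp [h0] at h1
    · choose g hg hgb using fun v => key v (f v) (hf v)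
      rw [← hgb u, ← hgb u']
      exact b.map_adj (x.2.2 g hg u u' huu')⟩

/-- The space `Hom_{ℤ₂}(G, G')` of all points `x` with `α ∗ x = x ∗ β`. -/
def HomEquivariant {V W : Type*} [Fintype W] {G : SimpleGraph V} {G' : SimpleGraph W}
    (α : GraphInvolution G) (β : GraphInvolution G') : Set (HomComplex G G') :=
  {x | HomComplex.precomp α.toHom x = HomComplex.postcomp β.toHom x}

/-- The vertices of `G^{ℤ₂}`: the orbits `{u, α u}`. -/
abbrev GraphInvolution.Orbit {V : Type*} {G : SimpleGraph V} (α : GraphInvolution G) : Type _ :=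
  {S : Set V // ∃ u, S = {u, α.toHom u}}

noncomputable instance {V : Type*} [Finite V] {G : SimpleGraph V} (α : GraphInvolution G) :
    Fintype α.Orbit := Fintype.ofFinite _

/-- The graph `G^{ℤ₂}`: the orbits of `u` and `v` are adjacent if `u` is adjacent to both `v` and
`α v`. -/
def GraphInvolution.fixedGraph {V : Type*} {G : SimpleGraph V} (α : GraphInvolution G) :
    SimpleGraph α.Orbit where
  Adj S T := ∃ u v, S.1 = {u, α.toHom u} ∧ T.1 = {v, α.toHom v} ∧
    G.Adj u v ∧ G.Adj u (α.toHom v)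
  symm := ⟨fun S T => by
    rintro ⟨u, v, hS, hT, h1, h2⟩
    refine ⟨v, u, hT, hS, h1.symm, ?_⟩
    have := α.toHom.map_adj h2
    rw [α.invol] at this
    exact this.symm⟩
  loopless := ⟨fun S => by
    rintro ⟨u, v, hS, hT, h1, h2⟩
    have hu : u ∈ ({v, α.toHom v} : Set V) := by
      rw [← hT, hS]; simp
    rcases hu with h | h
    · exact h1.ne h
    · exact h2.ne h⟩

end HomIndex

/-!
Write `X = Hom(G', H)`, `Y = Hom(G, H)` and `Z = Hom(G, G')`. Composition is a map `Z × X → Y` with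
`(α ∗ z) ∘ x = α ∗ (z ∘ x)` and `(z ∗ β) ∘ x = z ∘ (β ∗ x)`.

Replacing orbits by their barycentres turns a `ℤ/2`-map `S^(k-1) → Hom(G, G'^{ℤ₂})` into a map from
`S^(k-1)` to the points of `Z` with `z ∗ β = z`, equivariant for `α`. The involution
`z ↦ α ∗ z ∗ β` of `Z` has a fixed point, and `Z` is `(k-1)`-connected, so this map extends
equivariantly to the ball (`IsConn.exists_odd_extend`). Composition with the resulting family of
points of `Z` is a map `Ψ : ℝᵏ × X → Y` such that `(d, x) ↦ (-d, β x)` corresponds to the involution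
of `Y` everywhere, and `(d, x) ↦ (-d, x)` does so for `d` outside of the cross-polytope with
vertices `±e₁, …, ±eₖ`.

For a singular simplex `σ` of `X/ℤ₂` with a lift `σ'` to `X`, consider the image in `Y/ℤ₂` of the
product of the cross-polytope, triangulated as the sum of the simplices `[0, ±e₁, …, ±eₖ]`, with
`σ'`. It does not depend on the lift, and modulo 2 the boundary of the cross-polytope contributes
nothing, since opposite facets have the same image. Hence this is a chain map of degree `k`, and
evaluating cochains on it (`transfer`) commutes with the coboundary.

It remains to compute the transfer of `γ^(n + k)`. The pullback of `γ` to the sphere is the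
coboundary of a function `b` with `b (-x) = b x + 1`, so `γ^m` counts the simplices along whose
vertices `b` alternates (`cupPow_eq_alt`). In the product with the cross-polytope, summation over
the signs replaces each of the `k` steps in the direction of the cross-polytope by the factor `1`
(`signSum_shuffleSum_alt`). What remains is the sum over all ways to write `n = n₀ + … + nₖ` of the
products `γ^n₀ (δr₁)^n₁ ⋯ (δrₖ)^nₖ`, where the functions `rᵢ = b(Ψ(eᵢ, ·))` are defined on `X/ℤ₂`;
this is cohomologous to `γ^n` (`exists_cutSum_eq`). So if `γ^(n + k)` vanishes on `Y/ℤ₂`, then `γ^n`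
vanishes on `X/ℤ₂` (`isCoboundary_of_map`).

Ordered cochains are treated as functions on lists of vertices, for which products of simplices and
their boundaries are given by short recursions.
-/

namespace HomIndex

/-! ### Ordered cochains on lists -/

/-- The coboundary of a function on lists: the sum of its values on all lists that arise by
deleting one entry. The empty list counts as a face of a list with one entry. -/
def listD {P : Type*} : (List P → ZMod 2) → List P → ZMod 2
  | _, [] => 0
  | W, a :: l => W l + listD (fun l' => W (a :: l')) l

/-- The sum of `W` over all maximal chains in the grid `u × v`, which are the top-dimensional
simplices of the product of a simplex with vertices `u` and one with vertices `v`. It is zero if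
one of the lists is empty. -/
def shuffleSum {A B : Type*} : (List (A × B) → ZMod 2) → List A → List B → ZMod 2
  | _, [], _ => 0
  | _, _ :: _, [] => 0
  | W, a :: u, b :: v =>
      (if u = [] ∧ v = [] then W [(a, b)] else 0) +
        shuffleSum (fun l => W ((a, b) :: l)) u (b :: v) +
        shuffleSum (fun l => W ((a, b) :: l)) (a :: u) v
  termination_by _ u v => u.length + v.length

/-- The sum of `F` over all lists `[±r₁, …, ±rₖ]`. -/
def signSum {A : Type*} [Neg A] : (List A → ZMod 2) → List A → ZMod 2
  | F, [] => F []
  | F, r :: rs => signSum (fun l => F (r :: l)) rs + signSum (fun l => F (-r :: l)) rs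

/-- The product of the differences of `a` at consecutive entries: the power of the cocycle
`δa`, evaluated on the simplex with the given vertices. It is `1` if the values of `a` alternate
along a nonempty list, and `0` otherwise. -/
def alt {B : Type*} (a : B → ZMod 2) : List B → ZMod 2
  | [] => 0
  | [_] => 1
  | b :: b' :: v => (a b + a b') * alt a (b' :: v)

lemma listD_add {P : Type*} (W W' : List P → ZMod 2) (l : List P) :
    listD (fun l => W l + W' l) l = listD W l + listD W' l := by
  induction l generalizing W W' with
  | nil => simp [listD]
  | cons a l ih => simp only [listD, ih]; ring

lemma listD_mul {P : Type*} (c : ZMod 2) (W : List P → ZMod 2) (l : List P) :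
    listD (fun l => c * W l) l = c * listD W l := by
  induction l generalizing W with
  | nil => simp [listD]
  | cons a l ih => simp only [listD, ih]; ring

lemma listD_zero {P : Type*} (l : List P) : listD (fun _ => 0) l = 0 := by
  simpa using listD_mul 0 (fun _ => (0 : ZMod 2)) l

lemma listD_ofFn {P : Type*} (W : List P → ZMod 2) {n : ℕ} (p : Fin (n + 1) → P) :
    listD W (List.ofFn p) = ∑ i : Fin (n + 1), W (List.ofFn fun j => p (i.succAbove j)) := by
  induction n generalizing W with
  | zero => simp [listD]
  | succ n ih =>
    rw [Fin.sum_univ_succ, List.ofFn_succ, listD, ih]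
    refine congrArg₂ (· + ·) rfl (Finset.sum_congr rfl fun i _ => ?_)
    rw [List.ofFn_succ (f := fun j => p (i.succ.succAbove j))]
    simp

lemma shuffleSum_nil_left {A B : Type*} (W : List (A × B) → ZMod 2) (v : List B) :
    shuffleSum W [] v = 0 := by simp [shuffleSum]

lemma shuffleSum_nil_right {A B : Type*} (W : List (A × B) → ZMod 2) (u : List A) :
    shuffleSum W u [] = 0 := by cases u <;> simp [shuffleSum]

lemma shuffleSum_cons {A B : Type*} (W : List (A × B) → ZMod 2) (a : A) (u : List A) (b : B)
    (v : List B) : shuffleSum W (a :: u) (b :: v) =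
      (if u = [] ∧ v = [] then W [(a, b)] else 0) +
        shuffleSum (fun l => W ((a, b) :: l)) u (b :: v) +
        shuffleSum (fun l => W ((a, b) :: l)) (a :: u) v := by
  rw [shuffleSum]

lemma shuffleSum_add {A B : Type*} (W W' : List (A × B) → ZMod 2) (u : List A) (v : List B) :
    shuffleSum (fun l => W l + W' l) u v = shuffleSum W u v + shuffleSum W' u v := by
  fun_induction shuffleSum W u v generalizing W' with
  | case1 | case2 => simp [shuffleSum]
  | case3 W a u b v ih1 ih2 =>
    rw [shuffleSum_cons, shuffleSum_cons, ih1, ih2]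
    split_ifs <;> ring

lemma shuffleSum_congr {A B : Type*} (W W' : List (A × B) → ZMod 2) (u : List A) (v : List B)
    (h : ∀ l : List (A × B), l.length + 1 = u.length + v.length →
      (∀ p ∈ l, p.1 ∈ u ∧ p.2 ∈ v) → W l = W' l) :
    shuffleSum W u v = shuffleSum W' u v := by
  fun_induction shuffleSum W u v generalizing W' with
  | case1 | case2 => simp [shuffleSum]
  | case3 W a u b v ih1 ih2 =>
    rw [shuffleSum_cons, ih1 (fun l => W' ((a, b) :: l)), ih2 (fun l => W' ((a, b) :: l))]
    · congr 2
      split_ifs with h'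
      · apply h <;> simp [h']
      · rfl
    · intro l hl hp
      apply h
      · simp at hl ⊢; omega
      · intro p hp'
        rcases List.mem_cons.1 hp' with rfl | hp'
        · simp
        · exact ⟨(hp p hp').1, List.mem_cons_of_mem _ (hp p hp').2⟩
    · intro l hl hp
      apply h
      · simp at hl ⊢; omega
      · intro p hp'
        rcases List.mem_cons.1 hp' with rfl | hp'
        · simp
        · exact ⟨List.mem_cons_of_mem _ (hp p hp').1, (hp p hp').2⟩

lemma shuffleSum_map {A B A' B' : Type*} (W : List (A' × B') → ZMod 2) (f : A → A') (g : B → B')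
    (u : List A) (v : List B) : shuffleSum W (u.map f) (v.map g) =
      shuffleSum (fun l => W (l.map (Prod.map f g))) u v := by
  suffices h : ∀ W₀ : List (A × B) → ZMod 2, W₀ = (fun l => W (l.map (Prod.map f g))) →
      shuffleSum W (u.map f) (v.map g) = shuffleSum W₀ u v from h _ rfl
  intro W₀ h
  fun_induction shuffleSum W₀ u v generalizing W with
  | case1 | case2 => simp [shuffleSum]
  | case3 W₀ a u b v ih1 ih2 =>
    subst h
    simp only [List.map_cons, shuffleSum_cons]
    have h1 := ih1 (fun l => W ((f a, g b) :: l)) (by simp)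
    have h2 := ih2 (fun l => W ((f a, g b) :: l)) (by simp)
    simp only [List.map_cons] at h1 h2
    rw [h1, h2]
    simp

/-- The boundary formula for the product of two simplices. The last summand comes from the empty
face of a vertex. -/
lemma shuffleSum_listD {A B : Type*} (W : List (A × B) → ZMod 2) (a : A) (u : List A)
    (b : B) (v : List B) :
    shuffleSum (listD W) (a :: u) (b :: v) =
      listD (fun u' => shuffleSum W u' (b :: v)) (a :: u) +
      listD (fun v' => shuffleSum W (a :: u) v') (b :: v) +
      (if u = [] ∧ v = [] then W [] else 0) := by
  induction h : u.length + v.length using Nat.strong_induction_on generalizing W a u b v with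
  | _ N ih =>
  have key : ∀ (x : A × B) u v, shuffleSum (fun l => listD W (x :: l)) u v =
      shuffleSum W u v + shuffleSum (listD fun l => W (x :: l)) u v := by
    intro x u v
    rw [← shuffleSum_add]; rfl
  -- splits `∂` of a product with first vertex `(a, b)` into the two kinds of faces
  have e1 : listD (fun u' => shuffleSum W u' (b :: v)) (a :: u) = shuffleSum W u (b :: v) +
      listD (fun u' => shuffleSum W (a :: u') (b :: v)) u := rfl
  have e2 : listD (fun v' => shuffleSum W (a :: u) v') (b :: v) = shuffleSum W (a :: u) v +
      listD (fun v' => shuffleSum W (a :: u) (b :: v')) v := rfl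
  have c2 : ∀ x : ZMod 2, x + x = 0 := CharTwo.add_self_eq_zero
  rw [shuffleSum_cons, key, key, e1, e2]
  set W' := fun l => W ((a, b) :: l) with hW'
  rcases u with _ | ⟨a', u⟩ <;> rcases v with _ | ⟨b', v⟩
  · simp [shuffleSum_nil_left, shuffleSum_nil_right, listD]
  · have h2 := ih _ (by simp at h ⊢; omega) W' a [] b' v rfl
    have f2 : listD (fun v' => shuffleSum W [a] (b :: v')) (b' :: v) =
        (if v = [] then W [(a, b)] else 0) +
          listD (fun v' => shuffleSum W' [a] v') (b' :: v) := by
      simp only [shuffleSum_cons W, shuffleSum_nil_left, listD_add, listD_zero, ← hW']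
      simp only [listD, true_and, reduceCtorEq, if_false, listD_zero]
      ring
    rw [f2, h2]
    simp only [listD, shuffleSum_nil_left, true_and, and_false, reduceCtorEq, if_false]
    simp only [hW']
    ring
  · have h1 := ih _ (by simp at h ⊢; omega) W' a' u b [] rfl
    have f1 : listD (fun u' => shuffleSum W (a :: u') [b]) (a' :: u) =
        (if u = [] then W [(a, b)] else 0) +
          listD (fun u' => shuffleSum W' u' [b]) (a' :: u) := by
      simp only [shuffleSum_cons W, shuffleSum_nil_right, listD_add, listD_zero, ← hW']
      simp only [listD, and_true, reduceCtorEq, if_false, listD_zero]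
      ring
    rw [f1, h1]
    simp only [listD, shuffleSum_nil_right, and_true, reduceCtorEq, if_false]
    simp only [hW']
    ring
  · have h1 := ih _ (by simp at h ⊢; omega) W' a' u b (b' :: v) rfl
    have h2 := ih _ (by simp at h ⊢; omega) W' a (a' :: u) b' v rfl
    have f1 : listD (fun u' => shuffleSum W (a :: u') (b :: b' :: v)) (a' :: u) =
        listD (fun u' => shuffleSum W' u' (b :: b' :: v)) (a' :: u) +
          listD (fun u' => shuffleSum W' (a :: u') (b' :: v)) (a' :: u) := by
      simp only [shuffleSum_cons W, listD_add, ← hW', and_false, reduceCtorEq, if_false, zero_add]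
    have f2 : listD (fun v' => shuffleSum W (a :: a' :: u) (b :: v')) (b' :: v) =
        listD (fun v' => shuffleSum W' (a' :: u) (b :: v')) (b' :: v) +
          listD (fun v' => shuffleSum W' (a :: a' :: u) v') (b' :: v) := by
      simp only [shuffleSum_cons W, listD_add, ← hW', false_and, reduceCtorEq, if_false, zero_add]
    have g1 : listD (fun u' => shuffleSum W' u' (b' :: v)) (a :: a' :: u) =
        shuffleSum W' (a' :: u) (b' :: v) +
          listD (fun u' => shuffleSum W' (a :: u') (b' :: v)) (a' :: u) := rfl
    have g2 : listD (fun v' => shuffleSum W' (a' :: u) v') (b :: b' :: v) =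
        shuffleSum W' (a' :: u) (b' :: v) +
          listD (fun v' => shuffleSum W' (a' :: u) (b :: v')) (b' :: v) := rfl
    rw [h1, h2, f1, f2, g1, g2]
    simp only [and_false, false_and, reduceCtorEq, if_false]
    linear_combination c2 (shuffleSum W' (a' :: u) (b' :: v))

/-! ### Sums over signs -/

section signSum

variable {A : Type*} [InvolutiveNeg A]

lemma signSum_congr (F F' : List A → ZMod 2) (rs : List A)
    (h : ∀ l, List.Forall₂ (fun x r => x = r ∨ x = -r) l rs → F l = F' l) :
    signSum F rs = signSum F' rs := by
  induction rs generalizing F F' with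
  | nil => exact h [] .nil
  | cons r rs ih =>
    simp only [signSum]
    rw [ih (fun l => F (r :: l)) (fun l => F' (r :: l)) fun l hl => h _ (.cons (.inl rfl) hl),
      ih (fun l => F (-r :: l)) (fun l => F' (-r :: l)) fun l hl => h _ (.cons (.inr rfl) hl)]

lemma signSum_add (F F' : List A → ZMod 2) (rs : List A) :
    signSum (fun l => F l + F' l) rs = signSum F rs + signSum F' rs := by
  induction rs generalizing F F' with
  | nil => rfl
  | cons r rs ih => simp only [signSum, ih]; ring

lemma signSum_mul (c : ZMod 2) (F : List A → ZMod 2) (rs : List A) :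
    signSum (fun l => c * F l) rs = c * signSum F rs := by
  induction rs generalizing F with
  | nil => rfl
  | cons r rs ih => simp only [signSum, ih]; ring

lemma signSum_neg (F : List A → ZMod 2) (rs : List A) :
    signSum (fun l => F (l.map (-·))) rs = signSum F rs := by
  induction rs generalizing F with
  | nil => rfl
  | cons r rs ih =>
    simp only [signSum, List.map_cons, neg_neg]
    rw [ih (fun l => F (-r :: l)), ih (fun l => F (r :: l)), add_comm]

/-- Summing over both signs of a deleted entry gives zero. -/
lemma signSum_listD (F : List A → ZMod 2) (rs : List A) : signSum (listD F) rs = 0 := by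
  induction rs generalizing F with
  | nil => rfl
  | cons r rs ih =>
    simp only [signSum, listD, signSum_add]
    rw [ih, ih, add_zero, CharTwo.add_self_eq_zero]

/-- A sum over all sign patterns of a function that takes the same value on opposite patterns. -/
lemma signSum_eq_zero_of_even (F : List A → ZMod 2) (r : A) (rs : List A)
    (h : ∀ l, List.Forall₂ (fun x r => x = r ∨ x = -r) l (r :: rs) → F (l.map (-·)) = F l) :
    signSum F (r :: rs) = 0 := by
  simp only [signSum]
  rw [← signSum_neg (fun l => F (-r :: l)),
    signSum_congr (fun l => F (-r :: l.map (-·))) (fun l => F (r :: l)),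
    CharTwo.add_self_eq_zero]
  intro l hl
  simpa using h (r :: l) (.cons (.inl rfl) hl)

lemma signSum_zero (rs : List A) :
    signSum (fun _ => (0 : ZMod 2)) rs = 0 := by
  simpa using signSum_mul 0 (fun _ => (0 : ZMod 2)) rs

lemma listD_signSum {P : Type*} (G : List A → List P → ZMod 2) (rs : List A)
    (v : List P) : listD (fun v => signSum (fun u => G u v) rs) v =
      signSum (fun u => listD (G u) v) rs := by
  induction rs generalizing G with
  | nil => rfl
  | cons r rs ih =>
    simp only [signSum, listD_add]
    rw [ih fun u => G (r :: u), ih fun u => G (-r :: u)]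

end signSum

/-! ### Counting alternating simplices -/

lemma shuffleSum_mul {A B : Type*} (c : ZMod 2) (W : List (A × B) → ZMod 2) (u : List A)
    (v : List B) : shuffleSum (fun l => c * W l) u v = c * shuffleSum W u v := by
  fun_induction shuffleSum W u v with
  | case1 | case2 => simp [shuffleSum]
  | case3 W a u b v ih1 ih2 =>
    rw [shuffleSum_cons, ih1, ih2]
    split_ifs <;> ring

/-- The value of the cocycle `δa` on the edge from `b` to the head of the list, `0` if the list is
empty. -/
def stepDiff {B : Type*} (a : B → ZMod 2) (b : B) : List B → ZMod 2
  | [] => 0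
  | b' :: _ => a b + a b'

/-- The number, modulo 2, of alternating maximal chains in a grid, by recursion on the first
step of the chain. -/
lemma shuffleSum_alt_cons {A B : Type*} (f : A × B → ZMod 2) (a : A) (u : List A) (b : B)
    (v : List B) : shuffleSum (alt f) (a :: u) (b :: v) =
      (if u = [] ∧ v = [] then 1 else 0) +
      stepDiff (fun a => f (a, b)) a u * shuffleSum (alt f) u (b :: v) +
      stepDiff (fun b => f (a, b)) b v * shuffleSum (alt f) (a :: u) v := by
  have key : ∀ a' u b' v, shuffleSum (fun l => alt f ((a, b) :: l)) (a' :: u) (b' :: v) =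
      (f (a, b) + f (a', b')) * shuffleSum (alt f) (a' :: u) (b' :: v) := by
    intro a' u b' v
    rw [← shuffleSum_mul, shuffleSum_cons, shuffleSum_cons]
    simp [alt]
  rw [shuffleSum_cons]
  rcases u with _ | ⟨a', u⟩ <;> rcases v with _ | ⟨b', v⟩ <;>
    simp [key, shuffleSum_nil_left, shuffleSum_nil_right, alt, stepDiff]

/-- The product of `alt a` on an initial segment, and so on: the sum over all ways of cutting a
simplex into consecutive faces, one for each of the functions `a, r₁, …, rₖ`, of the products of
the alternation cochains of these functions. -/
def cutSum {B : Type*} : (B → ZMod 2) → List (B → ZMod 2) → List B → ZMod 2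
  | a, [], v => alt a v
  | _, _ :: _, [] => 0
  | a, r :: rs, b :: v => cutSum r rs (b :: v) + stepDiff a b v * cutSum a (r :: rs) v
  termination_by _ rs v => (rs.length, v.length)

lemma cutSum_nil {B : Type*} (a : B → ZMod 2) (v : List B) : cutSum a [] v = alt a v := by
  rw [cutSum]

lemma cutSum_cons_nil {B : Type*} (a r : B → ZMod 2) (rs : List (B → ZMod 2)) :
    cutSum a (r :: rs) [] = 0 := by
  rw [cutSum]

lemma cutSum_cons_cons {B : Type*} (a r : B → ZMod 2) (rs : List (B → ZMod 2)) (b : B)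
    (v : List B) : cutSum a (r :: rs) (b :: v) =
      cutSum r rs (b :: v) + stepDiff a b v * cutSum a (r :: rs) v := by
  rw [cutSum]

lemma alt_congr_add_one {B : Type*} (a a' : B → ZMod 2) (v : List B)
    (h : ∀ b ∈ v, a b = a' b + 1) : alt a v = alt a' v := by
  fun_induction alt a v with
  | case1 => rfl
  | case2 b => rfl
  | case3 b b' v ih =>
    rw [alt, ih fun b hb => h b (List.mem_cons_of_mem _ hb), h b (by simp), h b' (by simp)]
    linear_combination CharTwo.add_self_eq_zero (1 : ZMod 2) * alt a' (b' :: v)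

lemma cutSum_congr_add_one {B : Type*} (a a' : B → ZMod 2) (rs : List (B → ZMod 2)) (v : List B)
    (h : ∀ b ∈ v, a b = a' b + 1) : cutSum a rs v = cutSum a' rs v := by
  rcases rs with _ | ⟨r, rs⟩
  · simpa only [cutSum_nil] using alt_congr_add_one a a' _ h
  · induction v with
    | nil => simp only [cutSum_cons_nil]
    | cons b v ih =>
      rw [cutSum_cons_cons, cutSum_cons_cons, ih fun b hb => h b (List.mem_cons_of_mem _ hb)]
      rcases v with _ | ⟨b', v⟩
      · rfl
      · simp only [stepDiff]
        rw [h b (by simp), h b' (by simp)]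
        linear_combination CharTwo.add_self_eq_zero (1 : ZMod 2) * cutSum a' (r :: rs) (b' :: v)

/-- Since `f` changes parity when the sign of one of the `rᵢ` changes, the steps from one row of
the grid to the next contribute a factor `1` after summation over the signs. -/
lemma signSum_shuffleSum_alt {A B : Type*} [InvolutiveNeg A] (f : A × B → ZMod 2) (a : A)
    (rs : List A) (v : List B) (h : ∀ r ∈ rs, ∀ b ∈ v, f (-r, b) = f (r, b) + 1) :
    signSum (fun l => shuffleSum (alt f) (a :: l) v) rs =
      cutSum (fun b => f (a, b)) (rs.map fun r b => f (r, b)) v := by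
  induction rs generalizing a v with
  | nil =>
    simp only [signSum, List.map_nil]
    induction v with
    | nil => simp [shuffleSum_nil_right, cutSum_nil, alt]
    | cons b v ih =>
      have ih := ih (by simp)
      rw [shuffleSum_alt_cons, shuffleSum_nil_left, ih]
      rcases v with _ | ⟨b', v⟩ <;> simp [cutSum_nil, alt, stepDiff]
  | cons r rs ih =>
    induction v with
    | nil =>
      simp only [shuffleSum_nil_right, List.map_cons, cutSum_cons_nil]
      simpa using signSum_mul 0 (fun _ => (0 : ZMod 2)) (r :: rs)
    | cons b v ihv =>
      have ihv := ihv fun r hr b hb => h r hr b (List.mem_cons_of_mem _ hb)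
      have hrs : ∀ r ∈ rs, ∀ b' ∈ b :: v, f (-r, b') = f (r, b') + 1 :=
        fun r hr => h r (List.mem_cons_of_mem _ hr)
      have step : ∀ r', signSum (fun l => shuffleSum (alt f) (a :: r' :: l) (b :: v)) rs =
          (f (a, b) + f (r', b)) *
            cutSum (fun b => f (r', b)) (rs.map fun r b => f (r, b)) (b :: v) +
          stepDiff (fun b => f (a, b)) b v *
            signSum (fun l => shuffleSum (alt f) (a :: r' :: l) v) rs := by
        intro r'
        rw [← ih r' (b :: v) hrs, ← signSum_mul, ← signSum_mul, ← signSum_add]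
        simp only [shuffleSum_alt_cons f a (r' :: _), stepDiff, reduceCtorEq, false_and, if_false,
          zero_add]
      simp only [signSum] at ihv ⊢
      rw [step, step, List.map_cons, cutSum_cons_cons,
        ← List.map_cons (f := fun r b => f (r, b)), ← ihv,
        cutSum_congr_add_one (fun b => f (-r, b)) (fun b => f (r, b)) _ _
          fun b' hb' => h r (by simp) b' hb', h r (by simp) b (by simp)]
      linear_combination (CharTwo.add_self_eq_zero (f (a, b) + f (r, b))) *
        cutSum (fun b => f (r, b)) (rs.map fun r b => f (r, b)) (b :: v)

lemma alt_map {A B : Type*} (a : B → ZMod 2) (g : A → B) (v : List A) :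
    alt a (v.map g) = alt (a ∘ g) v := by
  fun_induction alt (a ∘ g) v with
  | case1 | case2 => rfl
  | case3 b b' v ih =>
    simp only [List.map_cons, alt] at ih ⊢
    rw [ih]; rfl

lemma cutSum_map {A B : Type*} (a : B → ZMod 2) (rs : List (B → ZMod 2)) (g : A → B) (v : List A) :
    cutSum a rs (v.map g) = cutSum (a ∘ g) (rs.map (· ∘ g)) v := by
  induction rs generalizing a v with
  | nil => simp only [List.map_nil, cutSum_nil, alt_map]
  | cons r rs ih =>
    induction v with
    | nil => simp only [List.map_cons, List.map_nil, cutSum_cons_nil]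
    | cons b v ihv =>
      have h := ih r (b :: v)
      simp only [List.map_cons, cutSum_cons_cons] at h ihv ⊢
      rw [h, ihv]
      cases v <;> rfl

/-- The product of the cocycle `δa` and the cochain `F`. -/
def diffCup {B : Type*} (a : B → ZMod 2) (F : List B → ZMod 2) : List B → ZMod 2
  | b :: b' :: v => (a b + a b') * F (b' :: v)
  | _ => 0

lemma listD_diffCup {B : Type*} (a : B → ZMod 2) (F : List B → ZMod 2) (hF : F [] = 0)
    (v : List B) : listD (diffCup a F) v = diffCup a (listD F) v := by
  have c2 : ∀ x : ZMod 2, x + x = 0 := CharTwo.add_self_eq_zero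
  rcases v with _ | ⟨b, _ | ⟨b', v⟩⟩
  · simp [listD, diffCup]
  · simp [listD, diffCup]
  · simp only [listD, diffCup, listD_mul]
    rcases v with _ | ⟨b'', v⟩
    · simp [hF]
    · linear_combination a b'' * c2 (F (b'' :: v))

/-- The solution `M` of the equation `M = F + δa ∪ M`. -/
def cupSeries {B : Type*} (a : B → ZMod 2) (F : List B → ZMod 2) : List B → ZMod 2
  | [] => 0
  | [b] => F [b]
  | b :: b' :: v => F (b :: b' :: v) + (a b + a b') * cupSeries a F (b' :: v)

lemma cupSeries_eq {B : Type*} (a : B → ZMod 2) (F : List B → ZMod 2) (hF : F [] = 0) :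
    cupSeries a F = fun v => F v + diffCup a (cupSeries a F) v := by
  funext v
  rcases v with _ | ⟨b, _ | ⟨b', v⟩⟩ <;> simp [cupSeries, diffCup, hF]

lemma cupSeries_map {B : Type*} (τ : B → B) (p : ZMod 2) (a : B → ZMod 2)
    (ha : ∀ b, a (τ b) = a b + p) (F : List B → ZMod 2)
    (hF : ∀ v, F (v.map τ) = F v) (v : List B) :
    cupSeries a F (v.map τ) = cupSeries a F v := by
  fun_induction cupSeries a F v with
  | case1 => rfl
  | case2 b => exact hF [b]
  | case3 b b' v ih =>
    have := hF (b :: b' :: v)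
    simp only [List.map_cons, cupSeries] at this ih ⊢
    rw [this, ih, ha, ha]
    linear_combination CharTwo.add_self_eq_zero p * cupSeries a F (b' :: v)

/-- If two cochains `D` and `G` satisfy the same recursion up to a coboundary, they differ by
a coboundary. -/
lemma eq_add_listD_cupSeries {B : Type*} (a : B → ZMod 2) (D G F : List B → ZMod 2)
    (hF : F [] = 0) (hD0 : D [] = G [])
    (h : ∀ b v, D (b :: v) + diffCup a D (b :: v) =
      G (b :: v) + diffCup a G (b :: v) + listD F (b :: v)) (v : List B) :
    D v = G v + listD (cupSeries a F) v := by
  have e : ∀ v, listD (cupSeries a F) v =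
      listD F v + diffCup a (listD (cupSeries a F)) v := by
    intro v
    conv_lhs => rw [cupSeries_eq a F hF]
    rw [listD_add, listD_diffCup _ _ (by simp [cupSeries])]
  induction v with
  | nil => simp [hD0, listD]
  | cons b v ih =>
    have := h b v
    rw [e]
    rcases v with _ | ⟨b', v⟩
    · simpa [diffCup] using this
    · simp only [diffCup] at this ⊢
      rw [ih] at this
      linear_combination this - (a b + a b') *
        CharTwo.add_self_eq_zero (listD (cupSeries a F) (b' :: v))

lemma alt_add_diffCup {B : Type*} (a : B → ZMod 2) (b : B) (v : List B) :
    alt a (b :: v) + diffCup a (alt a) (b :: v) = if v = [] then 1 else 0 := by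
  rcases v with _ | ⟨b', v⟩
  · simp [alt, diffCup]
  · simp [alt, diffCup, CharTwo.add_self_eq_zero]

lemma listD_alt {B : Type*} (a : B → ZMod 2) (v : List B) : listD (alt a) v = 0 := by
  have h1 : ∀ v : List B, listD (fun l => if l = [] then 1 else 0) v =
      if v.length = 1 then 1 else 0 := by
    rintro (_ | ⟨b, v⟩)
    · simp [listD]
    · simp [listD, listD_zero]
  have h2 : ∀ v : List B, listD (fun l => if l.length = 1 then 1 else 0) v = 0 := by
    rintro (_ | ⟨b, v⟩)
    · simp [listD]
    · simp [listD, h1, CharTwo.add_self_eq_zero]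
  have h3 : alt a = fun v => (if v.length = 1 then 1 else 0) + diffCup a (alt a) v := by
    funext v
    rcases v with _ | ⟨b, _ | ⟨b', v⟩⟩ <;> simp [alt, diffCup]
  have h4 : ∀ v, listD (alt a) v = diffCup a (listD (alt a)) v := by
    intro v
    conv_lhs => rw [h3]
    rw [listD_add, h2, listD_diffCup _ _ (by rfl), zero_add]
  induction v with
  | nil => rfl
  | cons b v ih =>
    rw [h4]
    rcases v with _ | ⟨b', v⟩
    · rfl
    · simp [diffCup, ih]

/-- Alternation cochains of functions that differ by an invariant function are cohomologous. -/
lemma exists_alt_eq {B : Type*} (τ : B → B) (p : ZMod 2) (a a' : B → ZMod 2)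
    (ha : ∀ b, a (τ b) = a b + p) (ha' : ∀ b, a' (τ b) = a' b + p) :
    ∃ M : List B → ZMod 2, M [] = 0 ∧ (∀ v, M (v.map τ) = M v) ∧
      ∀ v, alt a v = alt a' v + listD M v := by
  set e : List B → ZMod 2 := fun v => match v with
    | [] => 0
    | b :: v => (a b + a' b) * alt a' (b :: v) with he
  have halt : ∀ v, alt a' (v.map τ) = alt a' v := by
    intro v
    fun_induction alt a' v with
    | case1 => rfl
    | case2 b => rfl
    | case3 b b' v ih =>
      simp only [List.map_cons, alt] at ih ⊢
      rw [ih, ha', ha']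
      linear_combination CharTwo.add_self_eq_zero p * alt a' (b' :: v)
  have hde : ∀ b v, listD e (b :: v) = e v + (a b + a' b) * alt a' v := by
    intro b v
    have h : alt a' v + listD (fun l => alt a' (b :: l)) v = 0 := listD_alt a' (b :: v)
    have h' : listD e (b :: v) = e v + listD (fun l => (a b + a' b) * alt a' (b :: l)) v := rfl
    rw [h', listD_mul]
    linear_combination (a b + a' b) * h - (a b + a' b) * CharTwo.add_self_eq_zero (alt a' v)
  refine ⟨cupSeries a e, rfl, cupSeries_map τ p a ha e ?_,
    eq_add_listD_cupSeries a (alt a) (alt a') e rfl rfl ?_⟩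
  · rintro (_ | ⟨b, v⟩)
    · rfl
    · have := halt (b :: v)
      simp only [he, List.map_cons] at this ⊢
      rw [this, ha, ha']
      linear_combination CharTwo.add_self_eq_zero p * alt a' (b :: v)
  · intro b v
    rw [hde, alt_add_diffCup]
    rcases v with _ | ⟨b', v⟩
    · simp [alt, diffCup, he]
    · simp only [alt, diffCup, reduceCtorEq, if_false]
      have c2 := CharTwo.add_self_eq_zero (alt a' (b' :: v))
      linear_combination (- (a' b + a' b' + a b + a b') ) * c2

/-- The sum over all cuts is cohomologous to the summand in which the first face is everything,
since the functions `rᵢ` are invariant. -/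
lemma exists_cutSum_eq {B : Type*} (τ : B → B) (p : ZMod 2) (a a' : B → ZMod 2)
    (ha : ∀ b, a (τ b) = a b + p) (ha' : ∀ b, a' (τ b) = a' b + p)
    (rs : List (B → ZMod 2)) (hrs : ∀ r ∈ rs, ∀ b, r (τ b) = r b) :
    ∃ M : List B → ZMod 2, M [] = 0 ∧ (∀ v, M (v.map τ) = M v) ∧
      ∀ v, cutSum a rs v = alt a' v + listD M v := by
  induction rs generalizing a a' p with
  | nil =>
    obtain ⟨M, h0, h1, h2⟩ := exists_alt_eq τ p a a' ha ha'
    refine ⟨M, h0, h1, fun v => ?_⟩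
    rw [← h2]
    exact cutSum_nil a v
  | cons r rs ih =>
    obtain ⟨M, h0, h1, h2⟩ := ih 0 r (fun _ => 0) (by simpa using hrs r (by simp)) (by simp)
      fun r hr => hrs r (List.mem_cons_of_mem _ hr)
    obtain ⟨M', h0', h1', h2'⟩ := exists_alt_eq τ p a a' ha ha'
    refine ⟨fun v => M' v + cupSeries a M v, by simp [h0', cupSeries], fun v => ?_, fun v => ?_⟩
    · simp only [h1', cupSeries_map τ p a ha M h1]
    · rw [listD_add, ← add_assoc, ← h2']
      refine eq_add_listD_cupSeries a (cutSum a (r :: rs)) (alt a) M h0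
        (by simp [cutSum_cons_nil, alt]) ?_ v
      intro b v
      rw [alt_add_diffCup, cutSum_cons_cons, h2]
      rcases v with _ | ⟨b', v⟩
      · simp [alt, diffCup, stepDiff]
      · simp only [alt, diffCup, stepDiff, reduceCtorEq, if_false]
        linear_combination (a b + a b') * CharTwo.add_self_eq_zero (cutSum a (r :: rs) (b' :: v))

/-! ### Equivariant extension of maps from spheres to balls -/

/-- In an `m`-connected space, a map that is defined on the boundary of a convex body of dimension
`n ≤ m + 1` extends to the body. -/
lemma IsConn.exists_extend_frontier {Z : Type*} [TopologicalSpace Z] {m : ℤ} (h : IsConn Z m)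
    {n : ℕ} (hn : (n : ℤ) ≤ m + 1) {K : Set (EuclideanSpace ℝ (Fin n))} (hK : Convex ℝ K)
    (hc : IsClosed K) (hb : Bornology.IsBounded K) (hi : (interior K).Nonempty)
    (f : EuclideanSpace ℝ (Fin n) → Z) (hf : ContinuousOn f (frontier K)) :
    ∃ g : EuclideanSpace ℝ (Fin n) → Z, ContinuousOn g K ∧ Set.EqOn g f (frontier K) := by
  obtain ⟨e, h1, h2, h3⟩ := exists_homeomorph_image_interior_closure_frontier_eq_unitBall hK hi hb
  rw [hc.closure_eq] at h2
  have hmem : ∀ x ∈ Metric.sphere (0 : EuclideanSpace ℝ (Fin n)) 1, e.symm x ∈ frontier K := by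
    intro x hx
    rw [← h3] at hx
    obtain ⟨y, hy, rfl⟩ := hx
    simpa using hy
  obtain ⟨g, hg⟩ := h n hn ⟨fun x => f (e.symm x),
    hf.comp_continuous (by fun_prop) fun x => hmem x x.2⟩
  have hmem' : ∀ x ∈ K, e x ∈ Metric.closedBall (0 : EuclideanSpace ℝ (Fin n)) 1 := by
    intro x hx
    rw [← h2]
    exact Set.mem_image_of_mem e hx
  classical
  refine ⟨fun x => if hx : e x ∈ Metric.closedBall (0 : EuclideanSpace ℝ (Fin n)) 1 then
    g ⟨e x, hx⟩ else f x, ?_, ?_⟩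
  · rw [continuousOn_iff_continuous_domRestrict]
    have : Continuous fun x : K => g ⟨e x, hmem' x x.2⟩ := by fun_prop
    refine this.congr fun x => ?_
    simp only [Set.domRestrict_apply]
    rw [dif_pos (hmem' x x.2)]
  · intro x hx
    have hs : e x ∈ Metric.sphere (0 : EuclideanSpace ℝ (Fin n)) 1 := by
      rw [← h3]; exact Set.mem_image_of_mem e hx
    have hb' := Metric.sphere_subset_closedBall hs
    have := hg ⟨e x, hs⟩
    simp only [ContinuousMap.coe_mk, Homeomorph.symm_apply_apply] at this
    simp only [dif_pos hb', this]

/-- The inclusion of the hyperplane of vectors whose first coordinate vanishes. -/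
noncomputable def consZero {n : ℕ} (x : EuclideanSpace ℝ (Fin n)) :
    EuclideanSpace ℝ (Fin (n + 1)) :=
  WithLp.toLp 2 (Fin.cons 0 x)

/-- The projection that forgets the first coordinate. -/
noncomputable def dropFirst {n : ℕ} (x : EuclideanSpace ℝ (Fin (n + 1))) :
    EuclideanSpace ℝ (Fin n) :=
  WithLp.toLp 2 fun i => x i.succ

lemma continuous_consZero {n : ℕ} : Continuous (consZero (n := n)) := by
  unfold consZero
  refine (PiLp.continuous_toLp 2 _).comp (continuous_pi fun i => ?_)
  refine Fin.cases ?_ (fun i => ?_) i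
  · simpa using continuous_const
  · simpa using by fun_prop

lemma continuous_dropFirst {n : ℕ} : Continuous (dropFirst (n := n)) := by
  unfold dropFirst
  fun_prop

lemma norm_consZero {n : ℕ} (x : EuclideanSpace ℝ (Fin n)) : ‖consZero x‖ = ‖x‖ := by
  simp [EuclideanSpace.norm_eq, consZero, Fin.sum_univ_succ]

lemma consZero_neg {n : ℕ} (x : EuclideanSpace ℝ (Fin n)) : consZero (-x) = -consZero x := by
  ext i
  refine Fin.cases ?_ (fun i => ?_) i <;> simp [consZero]

lemma dropFirst_neg {n : ℕ} (x : EuclideanSpace ℝ (Fin (n + 1))) :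
    dropFirst (-x) = -dropFirst x := by
  ext i; simp [dropFirst]

lemma consZero_dropFirst {n : ℕ} (x : EuclideanSpace ℝ (Fin (n + 1))) (h : x 0 = 0) :
    consZero (dropFirst x) = x := by
  ext i
  refine Fin.cases ?_ (fun i => ?_) i <;> simp [consZero, dropFirst, h]

/-- Let `T` be an involution with a fixed point on an `m`-connected space. Odd maps defined on a
sphere of dimension at most `m` extend to odd maps on the ball. By induction on the dimension, the
map extends to the equatorial ball, then to a half ball, whose boundary is a sphere on which it is
already defined, and by symmetry to the other half. -/
lemma IsConn.exists_odd_extend {Z : Type*} [TopologicalSpace Z] {m : ℤ} (h : IsConn Z m)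
    (T : Z → Z) (hT : Continuous T) (hTT : ∀ z, T (T z) = z) (z₀ : Z) (hz₀ : T z₀ = z₀)
    (n : ℕ) (hn : (n : ℤ) ≤ m + 1) (f : EuclideanSpace ℝ (Fin n) → Z)
    (hf : ContinuousOn f (Metric.sphere 0 1))
    (hodd : ∀ x ∈ Metric.sphere (0 : EuclideanSpace ℝ (Fin n)) 1, f (-x) = T (f x)) :
    ∃ g : EuclideanSpace ℝ (Fin n) → Z, ContinuousOn g (Metric.closedBall 0 1) ∧
      (∀ x ∈ Metric.closedBall (0 : EuclideanSpace ℝ (Fin n)) 1, g (-x) = T (g x)) ∧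
      Set.EqOn g f (Metric.sphere 0 1) := by
  induction n with
  | zero =>
    refine ⟨fun _ => z₀, continuousOn_const, fun _ _ => hz₀.symm, fun x hx => ?_⟩
    rw [Subsingleton.elim x 0] at hx
    simp at hx
  | succ n ih =>
    obtain ⟨g₀, hg₀, hg₀odd, hg₀f⟩ := ih (by push_cast at hn; omega) (f ∘ consZero)
      (hf.comp continuous_consZero.continuousOn fun x hx => by
        simpa [norm_consZero] using hx)
      fun x hx => by
        simp only [Function.comp, consZero_neg]
        exact hodd _ (by simpa [norm_consZero] using hx)
    set S : Set (EuclideanSpace ℝ (Fin (n + 1))) := Metric.sphere 0 1 with hS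
    set B : Set (EuclideanSpace ℝ (Fin (n + 1))) := Metric.closedBall 0 1 with hB
    have hcoord : Continuous fun x : EuclideanSpace ℝ (Fin (n + 1)) => x 0 := by fun_prop
    set K : Set (EuclideanSpace ℝ (Fin (n + 1))) := B ∩ {x | 0 ≤ x 0} with hK
    set E : Set (EuclideanSpace ℝ (Fin (n + 1))) := B ∩ {x | x 0 = 0} with hE
    have hKc : IsClosed K := Metric.isClosed_closedBall.inter (isClosed_le continuous_const hcoord)
    have hEc : IsClosed E := Metric.isClosed_closedBall.inter (isClosed_eq hcoord continuous_const)
    have hdrop : ∀ x ∈ E, ‖dropFirst x‖ = ‖x‖ := by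
      intro x hx
      rw [← norm_consZero, consZero_dropFirst x hx.2]
    -- on the equatorial ball the map of the induction step, on the sphere the given map
    classical
    let f' : EuclideanSpace ℝ (Fin (n + 1)) → Z :=
      fun x => if x 0 = 0 then g₀ (dropFirst x) else f x
    have hf'E : ∀ x ∈ E, f' x = g₀ (dropFirst x) := fun x hx => if_pos hx.2
    have hf'S : ∀ x ∈ S, f' x = f x := by
      intro x hx
      by_cases h0 : x 0 = 0
      · have hxE : x ∈ E := ⟨Metric.sphere_subset_closedBall hx, h0⟩
        rw [hf'E x hxE, hg₀f (by simpa [hdrop x hxE, hS] using hx)]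
        simp [consZero_dropFirst x h0]
      · exact if_neg h0
    have hf'c : ContinuousOn f' (E ∪ S) := by
      refine ContinuousOn.union_of_isClosed ?_ ?_ hEc Metric.isClosed_sphere
      · refine ContinuousOn.congr (hg₀.comp continuous_dropFirst.continuousOn fun x hx => ?_) hf'E
        simpa [hdrop x hx, hB] using hx.1
      · exact hf.congr hf'S
    have hfr : frontier K ⊆ E ∪ S := by
      intro x hx
      rw [hKc.frontier_eq] at hx
      by_contra hcon
      simp only [Set.mem_union, not_or] at hcon
      refine hx.2 (mem_interior.2 ⟨Metric.ball 0 1 ∩ {x | 0 < x 0}, fun y hy =>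
        ⟨Metric.ball_subset_closedBall hy.1, le_of_lt (Set.mem_ofPred.1 hy.2)⟩,
        Metric.isOpen_ball.inter (isOpen_lt continuous_const hcoord), ?_, ?_⟩)
      · have h1 : ‖x‖ ≤ 1 := by simpa [hB] using hx.1.1
        have h2 : ‖x‖ ≠ 1 := by simpa [hS] using hcon.2
        simpa using lt_of_le_of_ne h1 h2
      · exact lt_of_le_of_ne hx.1.2 fun h0 => hcon.1 ⟨hx.1.1, h0.symm⟩
    have hint : (interior K).Nonempty := by
      refine ⟨EuclideanSpace.single 0 (1 / 2), mem_interior.2 ⟨Metric.ball 0 1 ∩ {x | 0 < x 0},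
        fun y hy => ⟨Metric.ball_subset_closedBall hy.1, le_of_lt (Set.mem_ofPred.1 hy.2)⟩,
        Metric.isOpen_ball.inter (isOpen_lt continuous_const hcoord), ?_, ?_⟩⟩
      · simp; norm_num
      · simp
    obtain ⟨g₁, hg₁, hg₁f⟩ := h.exists_extend_frontier hn (K := K)
      ((convex_closedBall _ _).inter (convex_halfSpace_ge
        (f := fun x : EuclideanSpace ℝ (Fin (n + 1)) => x 0) ⟨fun _ _ => rfl, fun _ _ => rfl⟩ 0))
      hKc (Metric.isBounded_closedBall.subset Set.inter_subset_left) hint f' (hf'c.mono hfr)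
    have hfr' : ∀ x ∈ K, x 0 = 0 ∨ x ∈ S → x ∈ frontier K := by
      intro x hx hx'
      rw [hKc.frontier_eq]
      refine ⟨hx, fun hxi => ?_⟩
      rcases hx' with hx' | hx'
      · -- moving `x` in the direction of the negative first axis leaves `K`
        have hcont : Continuous fun t : ℝ => x - EuclideanSpace.single 0 t := by
          have h0 : Continuous fun t : ℝ => (WithLp.toLp 2 fun i => if i = 0 then t else 0 :
              EuclideanSpace ℝ (Fin (n + 1))) :=
            (PiLp.continuous_toLp 2 _).comp (continuous_pi fun i => by split_ifs <;> fun_prop)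
          refine ((continuous_const (y := x)).sub h0).congr fun t => ?_
          ext i
          simp
        have h2 : ∀ᶠ t in nhds (0 : ℝ), x - EuclideanSpace.single 0 t ∈ K := by
          refine hcont.continuousAt.eventually_mem ?_
          have h0 : x - EuclideanSpace.single 0 (0 : ℝ) = x := by ext; simp
          rw [h0]
          exact mem_interior_iff_mem_nhds.1 hxi
        obtain ⟨t, ht, ht0⟩ := ((h2.filter_mono nhdsWithin_le_nhds).and
          (self_mem_nhdsWithin (s := Set.Ioi (0 : ℝ)))).exists
        have := ht.2
        simp [hx'] at this ht0
        linarith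
      · have h1 : interior K ⊆ interior B := interior_mono Set.inter_subset_left
        have h2 := h1 hxi
        rw [hB, interior_closedBall _ one_ne_zero] at h2
        simp [hS] at h2 hx'
        linarith
    have hg₁E : ∀ x ∈ E, g₁ x = g₀ (dropFirst x) := fun x hx => by
      rw [hg₁f (hfr' x ⟨hx.1, hx.2.ge⟩ (.inl hx.2)), hf'E x hx]
    have hg₁S : ∀ x ∈ S, 0 ≤ x 0 → g₁ x = f x := fun x hx hx0 => by
      rw [hg₁f (hfr' x ⟨Metric.sphere_subset_closedBall hx, hx0⟩ (.inr hx)), hf'S x hx]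
    let g : EuclideanSpace ℝ (Fin (n + 1)) → Z := fun x => if 0 ≤ x 0 then g₁ x else T (g₁ (-x))
    have hgE : ∀ x ∈ B, x 0 ≤ 0 → g x = T (g₁ (-x)) := by
      intro x hx hx0
      rcases hx0.lt_or_eq with h0 | h0
      · exact if_neg (not_le.2 h0)
      · have hxE : x ∈ E := ⟨hx, h0⟩
        have hnE : -x ∈ E := ⟨by simpa [hB] using hx, by simp [h0]⟩
        rw [show g x = g₁ x from if_pos h0.ge, hg₁E _ hxE, hg₁E _ hnE, dropFirst_neg,
          hg₀odd _ (by simpa [hdrop x hxE, hB] using hx), hTT]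
    have hBneg : ∀ x ∈ B, -x ∈ B := fun x hx => by simpa [hB] using hx
    refine ⟨g, ?_, ?_, ?_⟩
    · have : B = (B ∩ {x | 0 ≤ x 0}) ∪ (B ∩ {x | x 0 ≤ 0}) := by
        rw [← Set.inter_union_distrib_left]
        refine (Set.inter_eq_left.2 fun x _ => le_total 0 (x 0)).symm
      rw [this]
      refine ContinuousOn.union_of_isClosed ?_ ?_ hKc
        (Metric.isClosed_closedBall.inter (isClosed_le hcoord continuous_const))
      · exact hg₁.congr fun x hx => if_pos hx.2
      · refine ContinuousOn.congr (f := fun x => T (g₁ (-x))) ?_ fun x hx => hgE x hx.1 hx.2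
        exact hT.comp_continuousOn (hg₁.comp continuous_neg.continuousOn fun x hx =>
          ⟨hBneg x hx.1, by simpa using hx.2⟩)
    · intro x hx
      rcases le_total 0 (x 0) with h0 | h0
      · rw [hgE (-x) (hBneg x hx) (by simpa using h0), neg_neg, show g x = g₁ x from if_pos h0]
      · rw [hgE x hx h0, hTT]
        exact if_pos (by simpa using h0)
    · intro x hx
      rcases le_total 0 (x 0) with h0 | h0
      · rw [show g x = g₁ x from if_pos h0, hg₁S x hx h0]
      · rw [hgE x (Metric.sphere_subset_closedBall hx) h0, hg₁S (-x) (by simpa [hS] using hx)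
          (by simpa using h0), hodd x hx, hTT]

/-! ### Free involutions and lifts of simplices -/

/-- The projection to the orbit space. -/
def orbitMk {X : Type*} [TopologicalSpace X] (τ : X → X) : C(X, OrbitSpace τ) :=
  ⟨Quot.mk _, continuous_quot_mk⟩

lemma orbitMk_apply_map {X : Type*} [TopologicalSpace X] (τ : X → X) (x : X) :
    orbitMk τ (τ x) = orbitMk τ x :=
  (Quot.sound (r := fun x y : X => y = τ x) rfl).symm

lemma orbitMk_eq_iff {X : Type*} [TopologicalSpace X] {τ : X → X} (hτ : ∀ x, τ (τ x) = x)
    {x y : X} : orbitMk τ x = orbitMk τ y ↔ x = y ∨ x = τ y := by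
  constructor
  · intro h
    let F : OrbitSpace τ → Set X := Quot.lift (fun x => {x, τ x}) (by
      rintro x _ rfl
      simp [hτ, Set.pair_comm])
    have h' : ({x, τ x} : Set X) = {y, τ y} := congrArg F h
    have hx : x ∈ ({y, τ y} : Set X) := by rw [← h']; simp
    simpa using hx
  · rintro (rfl | rfl)
    · rfl
    · exact orbitMk_apply_map τ y

/-- The action of the group of order two that is given by an involution. -/
abbrev involutionAction {X : Type*} {τ : X → X} (hτ : ∀ x, τ (τ x) = x) : MulAction ℤˣ X where
  smul g x := if g = 1 then x else τ x
  one_smul _ := if_pos rfl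
  mul_smul g h x := by
    change (if g * h = 1 then x else τ x) =
      if g = 1 then (if h = 1 then x else τ x) else τ (if h = 1 then x else τ x)
    rcases Int.units_eq_one_or g with rfl | rfl <;> rcases Int.units_eq_one_or h with rfl | rfl <;>
      simp [hτ]

lemma isCoveringMap_orbitMk {X : Type*} [TopologicalSpace X] [T2Space X] {τ : X → X}
    (hc : Continuous τ) (hτ : ∀ x, τ (τ x) = x) (hfree : ∀ x, τ x ≠ x) :
    IsCoveringMap (orbitMk τ) := by
  let _ := involutionAction hτ
  have hsmul : ∀ (g : ℤˣ) (x : X), g • x = if g = 1 then x else τ x := fun _ _ => rfl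
  have hq : IsQuotientCoveringMap (orbitMk τ) ℤˣ := by
    refine
    { toIsQuotientMap := isQuotientMap_quot_mk
      continuous_const_smul := fun g => ?_
      apply_eq_iff_mem_orbit := fun {x y} => ?_
      disjoint := fun x => ?_ }
    · simp only [hsmul]
      split_ifs
      · exact continuous_id
      · exact hc
    · rw [orbitMk_eq_iff hτ, MulAction.mem_orbit_iff]
      constructor
      · rintro (rfl | rfl)
        · exact ⟨1, one_smul _ _⟩
        · exact ⟨-1, by rw [hsmul, if_neg (by decide)]⟩
      · rintro ⟨g, rfl⟩
        rw [hsmul]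
        split_ifs <;> simp
    · obtain ⟨U, V, hU, hV, hxU, hxV, hUV⟩ := t2_separation (hfree x).symm
      refine ⟨U ∩ τ ⁻¹' V, (hU.inter (hV.preimage hc)).mem_nhds ⟨hxU, hxV⟩, fun g hg => ?_⟩
      by_contra hne
      obtain ⟨_, ⟨y, hy, rfl⟩, hy'⟩ := hg
      have hmem : g • y ∈ U := hy'.1
      rw [hsmul, if_neg hne] at hmem
      exact Set.disjoint_left.1 hUV hmem hy.2
  exact hq.isCoveringMap

instance (n : ℕ) : ContractibleSpace (stdSimplex ℝ (Fin (n + 1))) :=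
  (convex_stdSimplex ℝ _).contractibleSpace ⟨_, single_mem_stdSimplex ℝ 0⟩

/-- A simplex of the orbit space lifts: a contraction of the standard simplex makes it the end of a
homotopy that starts at a constant map. -/
lemma exists_lift {X : Type*} [TopologicalSpace X] [T2Space X] {τ : X → X}
    (hc : Continuous τ) (hτ : ∀ x, τ (τ x) = x) (hfree : ∀ x, τ x ≠ x) {n : ℕ}
    (s : SingSimplex (OrbitSpace τ) n) : ∃ s' : SingSimplex X n, (orbitMk τ).comp s' = s := by
  have hcov := isCoveringMap_orbitMk hc hτ hfree
  obtain ⟨a, ⟨F⟩⟩ := id_nullhomotopic (stdSimplex ℝ (Fin (n + 1)))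
  obtain ⟨x, hx⟩ := Quot.exists_rep (s a)
  let H : C(unitInterval × stdSimplex ℝ (Fin (n + 1)), OrbitSpace τ) :=
    s.comp F.symm.toContinuousMap
  have hH : ∀ b, H (0, b) = orbitMk τ (ContinuousMap.const _ x b) := by
    intro b
    change s (F.symm (0, b)) = _
    rw [F.symm.apply_zero]
    exact hx.symm
  refine ⟨(hcov.liftHomotopy H (ContinuousMap.const _ x) hH).comp
    ⟨fun b => (1, b), by fun_prop⟩, ?_⟩
  ext b
  have := congrFun (hcov.liftHomotopy_lifts H (ContinuousMap.const _ x) hH) (1, b)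
  change orbitMk τ _ = _ at this
  refine this.trans ?_
  change s (F.symm (1, b)) = _
  rw [F.symm.apply_one]
  rfl

lemma lift_unique {X : Type*} [TopologicalSpace X] [T2Space X] {τ : X → X}
    (hc : Continuous τ) (hτ : ∀ x, τ (τ x) = x) (hfree : ∀ x, τ x ≠ x) {n : ℕ}
    (s s' : SingSimplex X n) (h : (orbitMk τ).comp s = (orbitMk τ).comp s') :
    s = s' ∨ s = (⟨τ, hc⟩ : C(X, X)).comp s' := by
  have hcov := isCoveringMap_orbitMk hc hτ hfree
  have hpt : ∀ a, orbitMk τ (s a) = orbitMk τ (s' a) := fun a => congrArg (fun f => f a) h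
  have a : stdSimplex ℝ (Fin (n + 1)) := Classical.arbitrary _
  rcases (orbitMk_eq_iff hτ).1 (hpt a) with ha | ha
  · left
    exact DFunLike.coe_injective (hcov.eq_of_comp_eq s.continuous s'.continuous
      (funext fun b => hpt b) a ha)
  · right
    refine DFunLike.coe_injective (hcov.eq_of_comp_eq s.continuous (ContinuousMap.continuous _)
      (funext fun b => ?_) a ha)
    exact (hpt b).trans (orbitMk_apply_map τ (s' b)).symm

/-! ### Singular cochains -/

lemma restrict_apply_vertex {X : Type*} [TopologicalSpace X] {m n : ℕ} (s : SingSimplex X n)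
    (a : Fin (m + 1) → Fin (n + 1)) (i : Fin (m + 1)) :
    s.restrict a (stdSimplex.vertex i) = s (stdSimplex.vertex (a i)) := by
  change s (stdSimplex.map a _) = _
  rw [stdSimplex.map_vertex]

lemma restrict_comp {X Y : Type*} [TopologicalSpace X] [TopologicalSpace Y] {m n : ℕ}
    (f : C(X, Y)) (s : SingSimplex X n) (a : Fin (m + 1) → Fin (n + 1)) :
    SingSimplex.restrict (f.comp s) a = f.comp (s.restrict a) := rfl

lemma alt_ofFn {B : Type*} (b : B → ZMod 2) {n : ℕ} (p : Fin (n + 1) → B) :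
    alt b (List.ofFn p) = ∏ i : Fin n, (b (p i.castSucc) + b (p i.succ)) := by
  induction n with
  | zero => simp [alt]
  | succ n ih =>
    have := ih fun i => p i.succ
    rw [List.ofFn_succ] at this
    rw [List.ofFn_succ, List.ofFn_succ, alt, this, Fin.prod_univ_succ]
    rfl

/-- If the pullback of the 1-cochain `c` to `X` is the coboundary of `b`, then the powers of `c`
count alternations of `b` along the vertices of a lifted simplex. -/
lemma cupPow_eq_alt {X : Type*} [TopologicalSpace X] {Y : Type*} [TopologicalSpace Y] (q : C(X, Y))
    (c : Cochain Y 1) (b : X → ZMod 2)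
    (hb : ∀ s : SingSimplex X 1, c (q.comp s) =
      b (s (stdSimplex.vertex 0)) + b (s (stdSimplex.vertex 1)))
    (n : ℕ) (s : SingSimplex X n) :
    cupPow c n (q.comp s) = alt b (List.ofFn fun i => s (stdSimplex.vertex i)) := by
  rw [alt_ofFn]
  induction n with
  | zero => simp [cupPow]
  | succ n ih =>
    rw [cupPow, cup, restrict_comp, restrict_comp, hb]
    rw [ih, Fin.prod_univ_castSucc]
    simp only [restrict_apply_vertex]
    rfl

/-- The sum of a cocycle over the boundary of a square vanishes: the square is the union of two
triangles. -/
lemma IsCocycle.square {X : Type*} [TopologicalSpace X] {c : Cochain X 1} (hc : IsCocycle c)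
    (H : C(stdSimplex ℝ (Fin 2) × stdSimplex ℝ (Fin 2), X)) :
    c (H.comp ⟨fun r => (stdSimplex.vertex 0, r), by fun_prop⟩) +
      c (H.comp ⟨fun r => (r, stdSimplex.vertex 1), by fun_prop⟩) =
    c (H.comp ⟨fun r => (r, stdSimplex.vertex 0), by fun_prop⟩) +
      c (H.comp ⟨fun r => (stdSimplex.vertex 1, r), by fun_prop⟩) := by
  have hmap : ∀ {m n : ℕ} (a : Fin (m + 1) → Fin (n + 1)), Continuous (stdSimplex.map (S := ℝ) a) :=
    fun a => stdSimplex.continuous_map a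
  let T : (Fin 3 → Fin 2) → (Fin 3 → Fin 2) → SingSimplex X 2 := fun a a' =>
    H.comp ⟨fun r => (stdSimplex.map a r, stdSimplex.map a' r), by
      have := hmap (m := 2) (n := 1) a; have := hmap (m := 2) (n := 1) a'; fun_prop⟩
  let e : (Fin 2 → Fin 2) → (Fin 2 → Fin 2) → SingSimplex X 1 := fun a a' =>
    H.comp ⟨fun r => (stdSimplex.map a r, stdSimplex.map a' r), by
      have := hmap (m := 1) (n := 1) a; have := hmap (m := 1) (n := 1) a'; fun_prop⟩
  have hT : ∀ a a' i, (T a a').restrict (Fin.succAbove i) =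
      e (a ∘ i.succAbove) (a' ∘ i.succAbove) := by
    intro a a' i
    ext r
    change H (stdSimplex.map a (stdSimplex.map _ r), stdSimplex.map a' (stdSimplex.map _ r)) =
      H (stdSimplex.map _ r, stdSimplex.map _ r)
    rw [stdSimplex.map_comp_apply, stdSimplex.map_comp_apply]
  have hconst : ∀ (i : Fin 2) (r : stdSimplex ℝ (Fin 2)),
      stdSimplex.map (fun _ : Fin 2 => i) r = stdSimplex.vertex i := by
    intro i r
    ext j
    rw [stdSimplex.map_coe, FunOnFinite.linearMap_apply_apply, stdSimplex.vertex_coe]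
    by_cases hij : i = j
    · subst hij
      simp
    · simp [hij, Ne.symm hij]
  have hid : ∀ r : stdSimplex ℝ (Fin 2), stdSimplex.map (id : Fin 2 → Fin 2) r = r :=
    fun r => stdSimplex.map_id_apply r
  have f0 : Fin.succAbove (0 : Fin 3) = ![1, 2] := by decide
  have f1 : Fin.succAbove (1 : Fin 3) = ![0, 2] := by decide
  have f2 : Fin.succAbove (2 : Fin 3) = ![0, 1] := by decide
  have hδ : ∀ a a' : Fin 3 → Fin 2,
      c (e (a ∘ ![1, 2]) (a' ∘ ![1, 2])) + c (e (a ∘ ![0, 2]) (a' ∘ ![0, 2])) +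
      c (e (a ∘ ![0, 1]) (a' ∘ ![0, 1])) = 0 := by
    intro a a'
    have h : ∑ i : Fin 3, c ((T a a').restrict (Fin.succAbove i)) = 0 := congrFun hc (T a a')
    rw [Fin.sum_univ_three, hT, hT, hT] at h
    rw [← f0, ← f1, ← f2]
    exact h
  have a1 : (![0, 0, 1] : Fin 3 → Fin 2) ∘ ![1, 2] = id := by decide
  have a2 : (![0, 0, 1] : Fin 3 → Fin 2) ∘ ![0, 2] = id := by decide
  have a3 : (![0, 0, 1] : Fin 3 → Fin 2) ∘ ![0, 1] = fun _ => 0 := by decide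
  have a4 : (![0, 1, 1] : Fin 3 → Fin 2) ∘ ![1, 2] = fun _ => 1 := by decide
  have a5 : (![0, 1, 1] : Fin 3 → Fin 2) ∘ ![0, 2] = id := by decide
  have a6 : (![0, 1, 1] : Fin 3 → Fin 2) ∘ ![0, 1] = id := by decide
  have h1 := hδ ![0, 0, 1] ![0, 1, 1]
  have h2 := hδ ![0, 1, 1] ![0, 0, 1]
  rw [a1, a2, a3, a4, a5, a6] at h1 h2
  have e1 : e id (fun _ => 1) = H.comp ⟨fun r => (r, stdSimplex.vertex 1), by fun_prop⟩ := by
    ext r; simp only [e, ContinuousMap.comp_apply, ContinuousMap.coe_mk, hid, hconst]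
  have e2 : e (fun _ => 0) id = H.comp ⟨fun r => (stdSimplex.vertex 0, r), by fun_prop⟩ := by
    ext r; simp only [e, ContinuousMap.comp_apply, ContinuousMap.coe_mk, hid, hconst]
  have e3 : e (fun _ => 1) id = H.comp ⟨fun r => (stdSimplex.vertex 1, r), by fun_prop⟩ := by
    ext r; simp only [e, ContinuousMap.comp_apply, ContinuousMap.coe_mk, hid, hconst]
  have e4 : e id (fun _ => 0) = H.comp ⟨fun r => (r, stdSimplex.vertex 0), by fun_prop⟩ := by
    ext r; simp only [e, ContinuousMap.comp_apply, ContinuousMap.coe_mk, hid, hconst]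
  rw [e1, e2] at h1
  rw [e3, e4] at h2
  have key : ∀ x y z w d : ZMod 2, x + d + y = 0 → z + d + w = 0 → y + x = w + z := by decide
  exact key _ _ _ _ _ h1 h2

lemma IsCocycle.const {X : Type*} [TopologicalSpace X] {c : Cochain X 1} (hc : IsCocycle c)
    (x : X) : c (ContinuousMap.const _ x) = 0 := by
  have h : ∑ _i : Fin 3, c (ContinuousMap.const _ x) = 0 := congrFun hc (ContinuousMap.const _ x)
  rw [Fin.sum_univ_three] at h
  have : ∀ y : ZMod 2, y + y + y = 0 → y = 0 := by decide
  exact this _ h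

lemma IsCocycle.pullback {X Y : Type*} [TopologicalSpace X] [TopologicalSpace Y] {n : ℕ}
    {c : Cochain Y n} (hc : IsCocycle c) (f : C(X, Y)) : IsCocycle (Cochain.pullback f c) :=
  funext fun s => congrFun hc (f.comp s)

/-! ### The infinite sphere -/

namespace InfSph

lemma continuous_incl (n : ℕ) : Continuous (incl n) :=
  continuous_iSup_rng (i := n) continuous_coinduced_rng

lemma continuous_dom_iff {Y : Type*} [TopologicalSpace Y] {f : InfSph → Y} :
    Continuous f ↔ ∀ n, Continuous (f ∘ incl n) := by
  refine continuous_iSup_dom.trans (forall_congr' fun n => continuous_coinduced_dom)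

lemma incl_apply (n : ℕ) (x : Sph n) (i : ℕ) (h : i < n + 1) : (incl n x).1 i = x.1 ⟨i, h⟩ :=
  dif_pos h

lemma incl_apply_of_lt (n : ℕ) (x : Sph n) (i : ℕ) (h : n < i) : (incl n x).1 i = 0 :=
  dif_neg (by omega)

lemma continuous_coord (i : ℕ) : Continuous fun x : InfSph => x.1 i := by
  rw [continuous_dom_iff]
  intro n
  by_cases h : i < n + 1
  · refine Continuous.congr (f := fun x : Sph n => x.1 ⟨i, h⟩) (by fun_prop) fun x => ?_
    exact (incl_apply n x i h).symm
  · refine Continuous.congr (f := fun x : Sph n => (0 : ℝ)) (by fun_prop) fun x => ?_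
    exact (incl_apply_of_lt n x i (by omega)).symm

instance : T2Space InfSph :=
  T2Space.of_injective_continuous (f := fun x : InfSph => x.1) Subtype.val_injective
    (continuous_pi continuous_coord)

lemma continuous_antipode : Continuous antipode := by
  rw [continuous_dom_iff]
  intro n
  refine ((continuous_incl n).comp continuous_neg).congr fun x => Subtype.ext (funext fun i => ?_)
  by_cases h : i < n + 1
  · exact (incl_apply n _ i h).trans (congrArg Neg.neg (incl_apply n x i h)).symm
  · exact (incl_apply_of_lt n _ i (by omega)).trans
      (neg_eq_zero.2 (incl_apply_of_lt n x i (by omega))).symm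

lemma antipode_antipode (x : InfSph) : antipode (antipode x) = x :=
  Subtype.ext (funext fun i => neg_neg (x.1 i))

lemma sum_sq {x : InfSph} {N : ℕ} (h : ∀ i, N < i → x.1 i = 0) :
    ∑ i ∈ Finset.range (N + 1), x.1 i ^ 2 = 1 := by
  obtain ⟨n, h0, h1⟩ := x.2
  refine Eq.trans ?_ h1
  have key : ∀ m M, (∀ i, m < i → x.1 i = 0) → m ≤ M →
      ∑ i ∈ Finset.range (m + 1), x.1 i ^ 2 = ∑ i ∈ Finset.range (M + 1), x.1 i ^ 2 := by
    intro m M hm hM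
    refine Finset.sum_subset (Finset.range_mono (by omega)) fun i _ hi => ?_
    rw [hm i (by simpa using hi)]
    simp
  rcases le_total n N with hle | hle
  · exact (key n N h0 hle).symm
  · exact key N n h hle

lemma antipode_ne (x : InfSph) : antipode x ≠ x := by
  intro hx
  obtain ⟨n, -, h1⟩ := x.2
  have : ∀ i, x.1 i = 0 := fun i => by
    have := congrFun (congrArg Subtype.val hx) i
    change -x.1 i = x.1 i at this
    linarith
  simp [this] at h1

/-- A map with values in a finite-dimensional sphere is continuous if its coordinates are. -/
lemma continuous_of_coord {A : Type*} [TopologicalSpace A] (f : A → InfSph) (N : ℕ)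
    (hN : ∀ a i, N < i → (f a).1 i = 0) (hc : ∀ i, Continuous fun a => (f a).1 i) :
    Continuous f := by
  have hmem : ∀ a, (WithLp.toLp 2 fun i : Fin (N + 1) => (f a).1 i :
      EuclideanSpace ℝ (Fin (N + 1))) ∈ Metric.sphere 0 1 := by
    intro a
    have := sum_sq (hN a)
    rw [Finset.sum_range] at this
    simp [EuclideanSpace.norm_eq, this]
  have h : Continuous fun a => (⟨_, hmem a⟩ : Sph N) :=
    Continuous.subtype_mk ((PiLp.continuous_toLp 2 _).comp
      (continuous_pi fun i : Fin (N + 1) => hc i)) hmem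
  refine ((continuous_incl N).comp h).congr fun a => Subtype.ext (funext fun i => ?_)
  by_cases hi : i < N + 1
  · exact incl_apply N _ i hi
  · exact (incl_apply_of_lt N _ i (by omega)).trans (hN a i (by omega)).symm

/-- Compact subsets of the infinite sphere are finite-dimensional. -/
lemma exists_bound_of_isCompact {K : Set InfSph} (hK : IsCompact K) :
    ∃ N, ∀ x ∈ K, ∀ i, N < i → x.1 i = 0 := by
  by_contra! hcon
  choose x hx j hj hne using hcon
  -- a weighted sum of squares that is at least `N` at `x N`
  let w : ℕ → ℝ := fun i => ∑ N ∈ Finset.range i, if j N = i then (N : ℝ) / (x N).1 i ^ 2 else 0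
  have hw : ∀ i, 0 ≤ w i := fun i => Finset.sum_nonneg fun N _ => by split_ifs <;> positivity
  let φ : InfSph → ℝ := fun y => ∑' i, w i * y.1 i ^ 2
  have hsum : ∀ (y : InfSph) n, (∀ i, n < i → y.1 i = 0) →
      φ y = ∑ i ∈ Finset.range (n + 1), w i * y.1 i ^ 2 := by
    intro y n hy
    refine tsum_eq_sum fun i hi => ?_
    rw [hy i (by simpa using hi)]
    simp
  have hφ : Continuous φ := by
    rw [continuous_dom_iff]
    intro n
    refine Continuous.congr (f := fun y : Sph n =>
      ∑ i ∈ Finset.range (n + 1), w i * (incl n y).1 i ^ 2) ?_ fun y => ?_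
    · have := fun i => (continuous_coord i).comp (continuous_incl n)
      simp only [Function.comp_def] at this
      fun_prop
    · exact (hsum _ n (incl_apply_of_lt n y)).symm
  obtain ⟨C, hC⟩ := hK.bddAbove_image hφ.continuousOn
  obtain ⟨N, hN⟩ := exists_nat_gt C
  have h1 : φ (x N) ≤ C := hC ⟨_, hx N, rfl⟩
  obtain ⟨n, hn, -⟩ := (x N).2
  have hjn : j N ∈ Finset.range (n + 1) := by
    by_contra h
    exact hne N (hn _ (by simpa using h))
  have h2 : w (j N) * (x N).1 (j N) ^ 2 ≤ φ (x N) := by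
    rw [hsum _ n hn]
    exact Finset.single_le_sum (f := fun i => w i * (x N).1 i ^ 2)
      (fun i _ => mul_nonneg (hw i) (sq_nonneg _)) hjn
  have h3 : (N : ℝ) / (x N).1 (j N) ^ 2 ≤ w (j N) := by
    have := Finset.single_le_sum (s := Finset.range (j N))
      (f := fun M => if j M = j N then (M : ℝ) / (x M).1 (j N) ^ 2 else 0)
      (fun M _ => by split_ifs <;> positivity) (Finset.mem_range.2 (hj N))
    simpa using this
  have h4 : 0 < (x N).1 (j N) ^ 2 := by have := hne N; positivity
  rw [div_le_iff₀ h4] at h3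
  linarith

/-- The vector `(1 - t) x + t (1 - t) S x + t e₀`, where `S` is the shift. It is not zero if `x`
is not zero: for `t ≠ 0, 1` the entry after the last nonzero entry of `x` is not zero. -/
def contractAux (t : ℝ) (x : ℕ → ℝ) : ℕ → ℝ
  | 0 => (1 - t) * x 0 + t
  | i + 1 => (1 - t) * x (i + 1) + t * (1 - t) * x i

/-- The square of the norm of a vector of which only the first `N + 1` entries are nonzero. -/
def sqNorm (N : ℕ) (y : ℕ → ℝ) : ℝ := ∑ i ∈ Finset.range (N + 1), y i ^ 2

lemma contractAux_eq_zero {t : ℝ} {x : ℕ → ℝ} {N : ℕ} (h : ∀ i, N < i → x i = 0) (i : ℕ)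
    (hi : N + 1 < i) : contractAux t x i = 0 := by
  obtain ⟨i, rfl⟩ : ∃ j, i = j + 1 := ⟨i - 1, by omega⟩
  simp [contractAux, h (i + 1) (by omega), h i (by omega)]

lemma exists_contractAux_ne_zero (t : ℝ) (x : InfSph) : ∃ i, contractAux t x.1 i ≠ 0 := by
  classical
  by_contra! h
  obtain ⟨n, h0, h1⟩ := x.2
  by_cases ht : t = 1
  · have := h 0
    simp [contractAux, ht] at this
  by_cases ht0 : t = 0
  · have : ∀ i, x.1 i = 0 := by
      rintro (_ | i)
      · simpa [contractAux, ht0] using h 0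
      · simpa [contractAux, ht0] using h (i + 1)
    simp [this] at h1
  -- downward induction from the last entry
  · have hx : ∀ j i, n < i + j → x.1 i = 0 := by
      intro j
      induction j with
      | zero => intro i hi; exact h0 i hi
      | succ j ih =>
        intro i hi
        have := h (i + 1)
        simp only [contractAux, ih (i + 1) (by omega), mul_zero, zero_add, mul_eq_zero] at this
        rcases this with (h' | h') | h'
        · exact absurd h' ht0
        · exact absurd (by linarith) ht
        · exact h'
    simp [fun i => hx (n + 1) i (by omega)] at h1

lemma sqNorm_contractAux_pos {t : ℝ} {x : InfSph} {N : ℕ} (h : ∀ i, N < i → x.1 i = 0) :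
    0 < sqNorm (N + 1) (contractAux t x.1) := by
  obtain ⟨i, hi⟩ := exists_contractAux_ne_zero t x
  have hi' : i ∈ Finset.range (N + 1 + 1) := by
    by_contra hcon
    exact hi (contractAux_eq_zero h i (by simpa using hcon))
  exact Finset.sum_pos' (fun i _ => sq_nonneg _) ⟨i, hi', by positivity⟩

lemma exists_bound (x : InfSph) : ∃ N, ∀ i, N < i → x.1 i = 0 := by
  obtain ⟨n, h, -⟩ := x.2
  exact ⟨n, h⟩

/-- The deformation of the infinite sphere to the point `e₀`. -/
noncomputable def contract (t : ℝ) (x : InfSph) : InfSph :=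
  ⟨fun i => contractAux t x.1 i / √(sqNorm ((exists_bound x).choose + 1) (contractAux t x.1)),
    (exists_bound x).choose + 1,
    fun i hi => div_eq_zero_iff.2 (.inl (contractAux_eq_zero (exists_bound x).choose_spec i hi)),
    by
      have h := sqNorm_contractAux_pos (t := t) (exists_bound x).choose_spec
      simp only [div_pow, Real.sq_sqrt h.le, ← Finset.sum_div]
      exact div_self h.ne'⟩

lemma contract_apply {t : ℝ} {x : InfSph} {N : ℕ} (h : ∀ i, N < i → x.1 i = 0) (i : ℕ) :
    (contract t x).1 i = contractAux t x.1 i / √(sqNorm (N + 1) (contractAux t x.1)) := by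
  have key : ∀ m M, (∀ i, m < i → x.1 i = 0) → m ≤ M →
      sqNorm (m + 1) (contractAux t x.1) = sqNorm (M + 1) (contractAux t x.1) := by
    intro m M hm hM
    refine Finset.sum_subset (Finset.range_mono (by omega)) fun i _ hi => ?_
    rw [contractAux_eq_zero hm i (by simpa using hi)]
    simp
  have : sqNorm ((exists_bound x).choose + 1) (contractAux t x.1) =
      sqNorm (N + 1) (contractAux t x.1) := by
    rcases le_total (exists_bound x).choose N with hle | hle
    · exact key _ _ (exists_bound x).choose_spec hle
    · exact (key _ _ h hle).symm
  change contractAux t x.1 i / √(sqNorm ((exists_bound x).choose + 1) (contractAux t x.1)) = _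
  rw [this]

/-- The point `e₀`. -/
def base : InfSph := ⟨fun i => if i = 0 then 1 else 0, 0, fun i hi => by simp; omega, by simp⟩

lemma contract_zero (x : InfSph) : contract 0 x = x := by
  obtain ⟨N, hN⟩ := exists_bound x
  have h : contractAux 0 x.1 = x.1 := by
    funext i
    cases i <;> simp [contractAux]
  have hN' : ∀ i, N + 1 < i → x.1 i = 0 := fun i hi => hN i (by omega)
  refine Subtype.ext (funext fun i => ?_)
  rw [contract_apply hN, h, sqNorm, sum_sq hN', Real.sqrt_one, div_one]

lemma contract_one (x : InfSph) : contract 1 x = base := by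
  obtain ⟨N, hN⟩ := exists_bound x
  have h : contractAux 1 x.1 = fun i => if i = 0 then 1 else 0 := by
    funext i
    cases i <;> simp [contractAux]
  refine Subtype.ext (funext fun i => ?_)
  rw [contract_apply hN, h]
  simp [base, sqNorm]

lemma continuous_contract_comp {A : Type*} [TopologicalSpace A] [CompactSpace A] (t : A → ℝ)
    (s : A → InfSph) (ht : Continuous t) (hs : Continuous s) :
    Continuous fun a => contract (t a) (s a) := by
  obtain ⟨N, hN⟩ := exists_bound_of_isCompact (isCompact_range hs)
  replace hN : ∀ a i, N < i → (s a).1 i = 0 := fun a => hN _ ⟨a, rfl⟩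
  have hco : ∀ i, Continuous fun a => (s a).1 i := fun i => (continuous_coord i).comp hs
  have haux : ∀ i, Continuous fun a => contractAux (t a) (s a).1 i := by
    rintro (_ | i)
    · have := hco 0
      simp only [contractAux]
      fun_prop
    · have := hco i
      have := hco (i + 1)
      simp only [contractAux]
      fun_prop
  refine continuous_of_coord _ (N + 1) (fun a i hi => ?_) fun i => ?_
  · rw [contract_apply (hN a), contractAux_eq_zero (hN a) i hi, zero_div]
  · simp only [contract_apply (hN _)]
    refine (haux i).div ?_ fun a => (Real.sqrt_pos.2 (sqNorm_contractAux_pos (hN a))).ne'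
    simp only [sqNorm]
    fun_prop

/-- A 1-cocycle on the infinite sphere is the coboundary of its integral along the paths of the
deformation to the point `e₀`. -/
lemma exists_primitive {c : Cochain InfSph 1} (hc : IsCocycle c) :
    ∃ b : InfSph → ZMod 2, ∀ s : SingSimplex InfSph 1,
      c s = b (s (stdSimplex.vertex 0)) + b (s (stdSimplex.vertex 1)) := by
  have hcoe : Continuous fun r : stdSimplex ℝ (Fin 2) => r 1 :=
    (continuous_apply (1 : Fin 2)).comp continuous_subtype_val
  let path : InfSph → SingSimplex InfSph 1 := fun x =>
    ⟨fun r => contract (r 1) x, continuous_contract_comp _ _ hcoe continuous_const⟩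
  refine ⟨fun x => c (path x), fun s => ?_⟩
  let H : C(stdSimplex ℝ (Fin 2) × stdSimplex ℝ (Fin 2), InfSph) :=
    ⟨fun p => contract (p.1 1) (s p.2),
      continuous_contract_comp _ _ (hcoe.comp continuous_fst) (s.continuous.comp continuous_snd)⟩
  have h := hc.square H
  have e1 : H.comp ⟨fun r => (stdSimplex.vertex 0, r), by fun_prop⟩ = s := by
    ext1 r
    exact contract_zero (s r)
  have e2 : H.comp ⟨fun r => (stdSimplex.vertex 1, r), by fun_prop⟩ =
      ContinuousMap.const _ base := by
    ext1 r
    exact contract_one (s r)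
  rw [e1, e2, hc.const, add_zero] at h
  have key : ∀ x y z : ZMod 2, x + y = z → x = z + y := by decide
  exact key _ _ _ h

end InfSph

/-- The class `γ` is detected by a function on the infinite sphere that takes different values at
antipodal points. -/
lemma RepresentsGamma.exists_odd {c : Cochain InfProj 1} (hc : RepresentsGamma c) :
    ∃ b : InfSph → ZMod 2, (∀ x, b (InfSph.antipode x) = b x + 1) ∧
      ∀ s : SingSimplex InfSph 1, c ((orbitMk InfSph.antipode).comp s) =
        b (s (stdSimplex.vertex 0)) + b (s (stdSimplex.vertex 1)) := by
  obtain ⟨b, hb⟩ := InfSph.exists_primitive (hc.1.pullback (orbitMk InfSph.antipode))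
  refine ⟨b, ?_, hb⟩
  have hcoe : Continuous fun r : stdSimplex ℝ (Fin 2) => r 1 :=
    (continuous_apply (1 : Fin 2)).comp continuous_subtype_val
  -- `b ∘ antipode + b` is constant, since the infinite sphere is path connected
  have hconst : ∀ x, b (InfSph.antipode x) + b x =
      b (InfSph.antipode InfSph.base) + b InfSph.base := by
    intro x
    let s : SingSimplex InfSph 1 := ⟨fun r => InfSph.contract (r 1) x,
      InfSph.continuous_contract_comp _ _ hcoe continuous_const⟩
    let s' : SingSimplex InfSph 1 := (⟨_, InfSph.continuous_antipode⟩ : C(InfSph, InfSph)).comp s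
    have h : (orbitMk InfSph.antipode).comp s' = (orbitMk InfSph.antipode).comp s := by
      ext1 r
      exact orbitMk_apply_map _ (s r)
    have h0 : s (stdSimplex.vertex 0) = x := InfSph.contract_zero x
    have h1 : s (stdSimplex.vertex 1) = InfSph.base := InfSph.contract_one x
    have e : b (InfSph.antipode (s (stdSimplex.vertex 0))) +
        b (InfSph.antipode (s (stdSimplex.vertex 1))) =
        b (s (stdSimplex.vertex 0)) + b (s (stdSimplex.vertex 1)) :=
      (hb s').symm.trans ((congrArg c h).trans (hb s))
    rw [h0, h1] at e
    have key : ∀ x y z w : ZMod 2, x + y = z + w → x + z = y + w := by decide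
    exact key _ _ _ _ e
  -- if the constant were zero, `b` would descend to projective space
  by_contra! hne
  obtain ⟨x₀, hx₀⟩ := hne
  have heven : ∀ x, b (InfSph.antipode x) = b x := by
    have key : ∀ x y z w : ZMod 2, x ≠ y + 1 → x + y = z → w = z → w = 0 := by decide
    have key' : ∀ x y : ZMod 2, x + y = 0 → x = y := by decide
    exact fun x => key' _ _ (key _ _ _ _ hx₀ (hconst x₀) (hconst x))
  have hlift : ∀ x y, y = InfSph.antipode x → b x = b y := fun x y h => by rw [h, heven]
  refine hc.2 ⟨fun s => Quot.lift b hlift (s (stdSimplex.vertex 0)), ?_⟩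
  funext s
  obtain ⟨s, rfl⟩ := exists_lift InfSph.continuous_antipode InfSph.antipode_antipode
    InfSph.antipode_ne s
  refine Eq.trans ?_ (hb s).symm
  have h : ∀ i : Fin 2, SingSimplex.restrict (m := 0) ((orbitMk InfSph.antipode).comp s)
      (Fin.succAbove i) (stdSimplex.vertex 0) =
        orbitMk InfSph.antipode (s (stdSimplex.vertex (i.succAbove 0))) := by
    intro i
    rw [restrict_apply_vertex]
    rfl
  change ∑ i : Fin 2, Quot.lift b hlift (SingSimplex.restrict (m := 0)
    ((orbitMk InfSph.antipode).comp s) (Fin.succAbove i) (stdSimplex.vertex 0)) = _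
  rw [Fin.sum_univ_two, h, h, add_comm]
  rfl

/-! ### The transfer along products with a cross-polytope -/

section transfer

variable {X Z : Type*} [TopologicalSpace X] [TopologicalSpace Z] {k m n : ℕ}

/-- The singular simplex `r ↦ (∑ rᵢ dᵢ, σ (∑ rᵢ vᵢ))` of a product, where `(dᵢ, vᵢ)` are the points
`p i` with a vector `dᵢ` and a vertex `vᵢ` of the simplex `σ`. -/
noncomputable def prodSimplex (σ : SingSimplex X n)
    (p : Fin (m + 1) → EuclideanSpace ℝ (Fin k) × Fin (n + 1)) :
    SingSimplex (EuclideanSpace ℝ (Fin k) × X) m :=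
  ⟨fun r => (∑ i, r i • (p i).1, σ (stdSimplex.map (fun i => (p i).2) r)), by
    have h : ∀ i, Continuous fun r : stdSimplex ℝ (Fin (m + 1)) => r i :=
      fun i => (continuous_apply i).comp continuous_subtype_val
    exact (continuous_finsetSum _ fun i _ => (h i).smul continuous_const).prodMk
      (σ.continuous.comp (stdSimplex.continuous_map (S := ℝ) fun i => (p i).2))⟩

lemma prodSimplex_restrict {m' : ℕ} (σ : SingSimplex X n)
    (p : Fin (m + 1) → EuclideanSpace ℝ (Fin k) × Fin (n + 1)) (a : Fin (m' + 1) → Fin (m + 1)) :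
    (prodSimplex σ p).restrict a = prodSimplex σ (p ∘ a) := by
  ext1 r
  refine Prod.ext ?_ ?_
  · change ∑ i, stdSimplex.map a r i • (p i).1 = ∑ j, r j • (p (a j)).1
    classical
    simp only [stdSimplex.map_coe, FunOnFinite.linearMap_apply_apply, Finset.sum_smul]
    rw [← Finset.sum_fiberwise Finset.univ a]
    refine Finset.sum_congr rfl fun i _ => Finset.sum_congr rfl fun j hj => ?_
    rw [(Finset.mem_filter.1 hj).2]
  · change σ (stdSimplex.map _ (stdSimplex.map a r)) = σ (stdSimplex.map _ r)
    rw [stdSimplex.map_comp_apply]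
    rfl

lemma prodSimplex_vertex (σ : SingSimplex X n)
    (p : Fin (m + 1) → EuclideanSpace ℝ (Fin k) × Fin (n + 1)) (i : Fin (m + 1)) :
    prodSimplex σ p (stdSimplex.vertex i) = ((p i).1, σ (stdSimplex.vertex (p i).2)) := by
  refine Prod.ext ?_ ?_
  · change ∑ j, stdSimplex.vertex (S := ℝ) i j • (p j).1 = (p i).1
    rw [Finset.sum_eq_single i] <;> simp +contextual
  · change σ (stdSimplex.map _ _) = _
    rw [stdSimplex.map_vertex]

lemma prodSimplex_face {n' : ℕ} (σ : SingSimplex X n) (a : Fin (n' + 1) → Fin (n + 1))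
    (p : Fin (m + 1) → EuclideanSpace ℝ (Fin k) × Fin (n' + 1)) :
    prodSimplex (σ.restrict a) p = prodSimplex σ fun i => ((p i).1, a (p i).2) := by
  ext1 r
  refine Prod.ext rfl ?_
  change σ (stdSimplex.map a (stdSimplex.map _ r)) = σ (stdSimplex.map _ r)
  rw [stdSimplex.map_comp_apply]
  rfl

/-- The function on lists of points of a grid that is given by a singular cochain `w` and a map `F`
from the product. Only its values on lists of length `m + 1` are meaningful: shorter lists are
filled up with the pair `(0, 0)`, and longer ones are truncated. -/
noncomputable def gridCochain (w : Cochain Z m) (F : C(EuclideanSpace ℝ (Fin k) × X, Z))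
    (σ : SingSimplex X n) (l : List (EuclideanSpace ℝ (Fin k) × Fin (n + 1))) : ZMod 2 :=
  w (F.comp (prodSimplex σ fun i => l.getD i (0, 0)))

lemma gridCochain_ofFn (w : Cochain Z m) (F : C(EuclideanSpace ℝ (Fin k) × X, Z))
    (σ : SingSimplex X n) (p : Fin (m + 1) → EuclideanSpace ℝ (Fin k) × Fin (n + 1)) :
    gridCochain w F σ (List.ofFn p) = w (F.comp (prodSimplex σ p)) := by
  unfold gridCochain
  congr 3
  funext i
  simp [List.getD_eq_getElem?_getD, -List.ofFn_succ, Nat.le_of_lt_succ i.2]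

lemma exists_eq_ofFn {P : Type*} {l : List P} {m : ℕ} (h : l.length = m) :
    ∃ p : Fin m → P, l = List.ofFn p := by
  subst h
  exact ⟨_, (List.ofFn_get l).symm⟩

lemma listD_gridCochain (w : Cochain Z m) (F : C(EuclideanSpace ℝ (Fin k) × X, Z))
    (σ : SingSimplex X n) (p : Fin (m + 2) → EuclideanSpace ℝ (Fin k) × Fin (n + 1)) :
    listD (gridCochain w F σ) (List.ofFn p) = coboundary w (F.comp (prodSimplex σ p)) := by
  rw [listD_ofFn]
  refine Finset.sum_congr rfl fun i _ => ?_
  rw [restrict_comp, prodSimplex_restrict]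
  exact gridCochain_ofFn w F σ _

/-- The vertices `e₁, …, eₖ` of the cross-polytope. -/
noncomputable def axes (k : ℕ) : List (EuclideanSpace ℝ (Fin k)) :=
  List.ofFn fun i => EuclideanSpace.single i 1

/-- The value of `w` on the product of the cross-polytope, which is the sum of the simplices
`[0, ±e₁, …, ±eₖ]`, and the simplex `σ`. -/
noncomputable def transfer (w : Cochain Z m) (F : C(EuclideanSpace ℝ (Fin k) × X, Z))
    (σ : SingSimplex X n) : ZMod 2 :=
  signSum (fun u => shuffleSum (gridCochain w F σ) (0 :: u) (List.finRange (n + 1))) (axes k)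

/-- The `ℓ¹`-norm of a convex combination of vertices of a facet of the cross-polytope is at least
one. -/
lemma one_le_sum_abs_of_facet {u : List (EuclideanSpace ℝ (Fin k))}
    (hu : List.Forall₂ (fun x r => x = r ∨ x = -r) u (axes k))
    (d : Fin (m + 1) → EuclideanSpace ℝ (Fin k)) (hd : ∀ i, d i ∈ u)
    (r : stdSimplex ℝ (Fin (m + 1))) : 1 ≤ ∑ j, |(∑ i, r i • d i) j| := by
  -- the facet is the set where a linear functional with coefficients `±1` has value one
  obtain ⟨ε, hε, hε1⟩ : ∃ ε : Fin k → ℝ, (∀ j, |ε j| = 1) ∧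
      ∀ x ∈ u, ∑ j, ε j * x j = 1 := by
    have hlen : u.length = k := by simpa [axes] using hu.length_eq
    obtain ⟨p, rfl⟩ := exists_eq_ofFn hlen
    have hp : ∀ i, p i = EuclideanSpace.single i 1 ∨ p i = -EuclideanSpace.single i 1 := by
      intro i
      have := (List.forall₂_iff_get.1 hu).2 i (by simp) (by simp [axes])
      simpa [axes] using this
    refine ⟨fun j => p j j, fun j => ?_, fun x hx => ?_⟩
    · rcases hp j with h | h <;> simp [h]
    · obtain ⟨i, rfl⟩ := (List.mem_ofFn' _ _).1 hx
      rw [Finset.sum_eq_single i]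
      · rcases hp i with h | h <;> simp [h]
      · intro j _ hj
        rcases hp i with h | h <;> simp [h, hj]
      · simp
  calc (1 : ℝ) = ∑ i, r i * ∑ j, ε j * d i j := by simp [hε1 _ (hd _)]
    _ = ∑ j, ε j * (∑ i, r i • d i) j := by
      simp only [Finset.mul_sum, WithLp.ofLp_sum, Finset.sum_apply, PiLp.smul_apply, smul_eq_mul]
      rw [Finset.sum_comm]
      exact Finset.sum_congr rfl fun j _ => Finset.sum_congr rfl fun i _ => by ring
    _ ≤ ∑ j, |(∑ i, r i • d i) j| := by
      refine Finset.sum_le_sum fun j _ => (le_abs_self _).trans ?_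
      rw [abs_mul, hε, one_mul]

lemma prodSimplex_neg_fst (σ : SingSimplex X n)
    (p : Fin (m + 1) → EuclideanSpace ℝ (Fin k) × Fin (n + 1)) (r : stdSimplex ℝ (Fin (m + 1))) :
    prodSimplex σ (fun i => (-(p i).1, (p i).2)) r =
      (-(prodSimplex σ p r).1, (prodSimplex σ p r).2) := by
  refine Prod.ext ?_ rfl
  change ∑ i, r i • -(p i).1 = -∑ i, r i • (p i).1
  simp

variable {τ : X → X} (F : C(EuclideanSpace ℝ (Fin k) × X, Z))

/-- The product with the cross-polytope does not depend on the choice of the lift `σ`. -/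
lemma transfer_map (hτ : Continuous τ) (hF : ∀ d x, F (-d, τ x) = F (d, x)) (w : Cochain Z m)
    (σ : SingSimplex X n) (hm : m = k + n) :
    transfer w F ((⟨τ, hτ⟩ : C(X, X)).comp σ) = transfer w F σ := by
  unfold transfer
  rw [← signSum_neg]
  refine signSum_congr _ _ _ fun u hu => ?_
  have hlen : u.length = k := by simpa [axes] using hu.length_eq
  have h0 : (0 : EuclideanSpace ℝ (Fin k)) :: u.map (-·) = (0 :: u).map (-·) := by simp
  have hv : List.finRange (n + 1) = (List.finRange (n + 1)).map id := by simp
  rw [h0]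
  conv_lhs => rw [hv, shuffleSum_map]
  refine shuffleSum_congr _ _ _ _ fun l hl _ => ?_
  obtain ⟨p, rfl⟩ := exists_eq_ofFn (l := l) (m := m + 1) (by simp [hlen] at hl; omega)
  rw [List.map_ofFn, gridCochain_ofFn, gridCochain_ofFn]
  congr 1
  ext1 r
  have h1 := prodSimplex_neg_fst ((⟨τ, hτ⟩ : C(X, X)).comp σ) p r
  exact (congrArg F h1).trans (hF _ _)

/-- The sum over all facets of the boundary of the cross-polytope vanishes, since opposite facets
have the same image. -/
lemma signSum_facet_eq_zero (hF : ∀ d x, 1 ≤ ∑ j, |d j| → F (-d, x) = F (d, x))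
    (w : Cochain Z m) (σ : SingSimplex X n) (hm : m + 1 = k + n) (hk : 1 ≤ k) :
    signSum (fun u => shuffleSum (gridCochain w F σ) u (List.finRange (n + 1))) (axes k) = 0 := by
  obtain ⟨r, rs, hrs⟩ : ∃ r rs, axes k = r :: rs :=
    List.exists_cons_of_ne_nil (by simp [axes]; omega)
  rw [hrs]
  refine signSum_eq_zero_of_even _ _ _ fun u hu => ?_
  rw [← hrs] at hu
  have hlen : u.length = k := by simpa [axes] using hu.length_eq
  have hv : List.finRange (n + 1) = (List.finRange (n + 1)).map id := by simp
  conv_lhs => rw [hv, shuffleSum_map]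
  refine shuffleSum_congr _ _ _ _ fun l hl hmem => ?_
  obtain ⟨p, rfl⟩ := exists_eq_ofFn (l := l) (m := m + 1) (by simp [hlen] at hl; omega)
  rw [List.map_ofFn, gridCochain_ofFn, gridCochain_ofFn]
  congr 1
  ext1 r
  have h1 := prodSimplex_neg_fst σ p r
  refine (congrArg F h1).trans (hF _ _ ?_)
  exact one_le_sum_abs_of_facet hu (fun i => (p i).1)
    (fun i => (hmem _ ((List.mem_ofFn' _ _).2 ⟨i, rfl⟩)).1) r

/-- Suppose that the coboundary of `w` counts alternations of `B` on the product. Then the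
coboundary of the transfer of `w`, which is the last summand, counts alternations of `a` on `X`, up
to the coboundary of an invariant cochain `M`. -/
lemma alt_eq_of_coboundary_eq (B : EuclideanSpace ℝ (Fin k) × X → ZMod 2)
    (hF2 : ∀ d x, 1 ≤ ∑ j, |d j| → F (-d, x) = F (d, x))
    (hB1 : ∀ d x, B (-d, τ x) = B (d, x) + 1)
    (hB2 : ∀ d x, 1 ≤ ∑ j, |d j| → B (-d, x) = B (d, x) + 1)
    (hk : 1 ≤ k) (w : Cochain Z m)
    (hw : ∀ s : SingSimplex (EuclideanSpace ℝ (Fin k) × X) (m + 1), coboundary w (F.comp s) =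
      alt B (List.ofFn fun i => s (stdSimplex.vertex i)))
    (a : X → ZMod 2) (ha : ∀ x, a (τ x) = a x + 1) :
    ∃ M : List X → ZMod 2, M [] = 0 ∧ (∀ v, M (v.map τ) = M v) ∧
      ∀ (n : ℕ) (σ : SingSimplex X n), m + 1 = k + n →
        alt a (List.ofFn fun i => σ (stdSimplex.vertex i)) =
          listD M (List.ofFn fun i => σ (stdSimplex.vertex i)) +
          listD (fun v => signSum (fun u => shuffleSum (gridCochain w F σ) (0 :: u) v) (axes k))
            (List.finRange (n + 1)) := by
  have hone : ∀ r ∈ axes k, 1 ≤ ∑ j, |r j| := by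
    intro r hr
    obtain ⟨i, rfl⟩ := (List.mem_ofFn' _ _).1 hr
    rw [Finset.sum_eq_single i] <;> simp +contextual
  have hB3 : ∀ d x, 1 ≤ ∑ j, |d j| → B (d, τ x) = B (d, x) := by
    intro d x hd
    have h1 := hB1 (-d) x
    rw [neg_neg, hB2 d x hd] at h1
    have key : ∀ y z : ZMod 2, y = z + 1 + 1 → y = z := by decide
    exact key _ _ h1
  obtain ⟨M, hM0, hM1, hM2⟩ := exists_cutSum_eq τ 1 (fun x => B (0, x)) a
    (fun x => by simpa using hB1 0 x) ha ((axes k).map fun r x => B (r, x)) (by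
      intro r hr x
      obtain ⟨d, hd, rfl⟩ := List.mem_map.1 hr
      exact hB3 d x (hone d hd))
  refine ⟨M, hM0, hM1, fun n σ hm => ?_⟩
  set L := List.ofFn fun i => σ (stdSimplex.vertex i) with hL
  have hLmap : L = (List.finRange (n + 1)).map fun i => σ (stdSimplex.vertex i) := by
    rw [hL, List.ofFn_eq_map]
  let f : EuclideanSpace ℝ (Fin k) × Fin (n + 1) → ZMod 2 :=
    fun p => B (p.1, σ (stdSimplex.vertex p.2))
  -- counting alternations in the product with the cross-polytope
  have h1 : signSum (fun u => shuffleSum (alt f) (0 :: u) (List.finRange (n + 1))) (axes k) =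
      cutSum (fun x => B (0, x)) ((axes k).map fun r x => B (r, x)) L := by
    rw [signSum_shuffleSum_alt f 0 (axes k) _ fun r hr b _ => hB2 _ _ (hone r hr), hLmap,
      cutSum_map, List.map_map]
    rfl
  -- the boundary formula
  have h2 : signSum (fun u => shuffleSum (alt f) (0 :: u) (List.finRange (n + 1))) (axes k) =
      signSum (fun u => shuffleSum (listD (gridCochain w F σ)) (0 :: u) (List.finRange (n + 1)))
        (axes k) := by
    refine signSum_congr _ _ _ fun u hu => ?_
    have hlen : u.length = k := by simpa [axes] using hu.length_eq
    refine shuffleSum_congr _ _ _ _ fun l hl _ => ?_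
    obtain ⟨p, rfl⟩ := exists_eq_ofFn (l := l) (m := m + 2) (by simp [hlen] at hl; omega)
    rw [listD_gridCochain, hw, alt_ofFn, alt_ofFn]
    simp only [prodSimplex_vertex]
    rfl
  have h3 : signSum (fun u => shuffleSum (listD (gridCochain w F σ)) (0 :: u)
      (List.finRange (n + 1))) (axes k) =
      listD (fun v => signSum (fun u => shuffleSum (gridCochain w F σ) (0 :: u) v) (axes k))
            (List.finRange (n + 1)) := by
    rw [listD_signSum]
    have hfacet := signSum_facet_eq_zero F hF2 w σ hm hk
    have hinner := signSum_listD
      (fun u => shuffleSum (gridCochain w F σ) (0 :: u) (List.finRange (n + 1))) (axes k)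
    rw [← zero_add (signSum (fun u => listD _ _) _), ← zero_add (0 : ZMod 2)]
    nth_rewrite 1 [← hfacet]
    rw [← hinner, ← signSum_add, ← signSum_add]
    refine signSum_congr _ _ _ fun u hu => ?_
    have hlen : u.length = k := by simpa [axes] using hu.length_eq
    have hu0 : u ≠ [] := by rintro rfl; simp at hlen; omega
    rw [List.finRange_succ, shuffleSum_listD, if_neg (by simp [hu0]), add_zero]
    rfl
  rw [← h3, ← h2, h1, hM2 L]
  linear_combination -CharTwo.add_self_eq_zero (listD M L)

/-- The coboundary of the transfer, as a sum of values of the transfer on the faces of `σ`. -/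
lemma listD_eq_sum_transfer (w : Cochain Z m) (σ : SingSimplex X (n + 1)) (hm : m = k + n) :
    listD (fun v => signSum (fun u => shuffleSum (gridCochain w F σ) (0 :: u) v) (axes k))
      (List.finRange (n + 2)) =
    ∑ i : Fin (n + 2), transfer w F (σ.restrict i.succAbove) := by
  rw [← List.ofFn_id, listD_ofFn]
  refine Finset.sum_congr rfl fun i _ => signSum_congr _ _ _ fun u hu => ?_
  have hlen : u.length = k := by simpa [axes] using hu.length_eq
  have h1 : (List.ofFn fun j => id (i.succAbove j)) =
      (List.finRange (n + 1)).map i.succAbove := by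
    rw [List.ofFn_eq_map]; rfl
  have h2 : (0 :: u) = (0 :: u).map id := by simp
  rw [h1]
  conv_lhs => rw [h2, shuffleSum_map]
  refine shuffleSum_congr _ _ _ _ fun l hl _ => ?_
  obtain ⟨p, rfl⟩ := exists_eq_ofFn (l := l) (m := m + 1) (by simp [hlen] at hl; omega)
  rw [List.map_ofFn, gridCochain_ofFn, gridCochain_ofFn, prodSimplex_face]
  rfl

end transfer

/-- Let `k ≥ 1`, and let `Ψ : ℝᵏ × X → Y` be a map that is equivariant for the action
`(d, x) ↦ (-d, τ x)`, and outside of the cross-polytope also for `(d, x) ↦ (-d, x)`. If `γ^(n + k)`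
vanishes on `Y/ℤ₂`, then `γ^n` vanishes on `X/ℤ₂`. -/
theorem isCoboundary_of_map {X Y : Type*} [TopologicalSpace X] [T2Space X] [TopologicalSpace Y]
    {τ : X → X} (hτc : Continuous τ) (hτ : ∀ x, τ (τ x) = x) {τ' : Y → Y} {k : ℕ} (hk : 1 ≤ k)
    (Ψ : C(EuclideanSpace ℝ (Fin k) × X, Y)) (hΨ1 : ∀ d x, Ψ (-d, τ x) = τ' (Ψ (d, x)))
    (hΨ2 : ∀ d x, 1 ≤ ∑ j, |d j| → Ψ (-d, x) = τ' (Ψ (d, x)))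
    (f : C(X, InfSph)) (hf : IsZ2Map τ InfSph.antipode f)
    (f' : C(Y, InfSph)) (hf' : IsZ2Map τ' InfSph.antipode f')
    {c : Cochain InfProj 1} (hc : RepresentsGamma c) (n : ℕ)
    (h : IsCoboundary (Cochain.pullback (orbitMap f' hf') (cupPow c (n + k)))) :
    IsCoboundary (Cochain.pullback (orbitMap f hf) (cupPow c n)) := by
  obtain ⟨b, hb1, hb2⟩ := hc.exists_odd
  have hfree : ∀ x, τ x ≠ x := fun x hx => InfSph.antipode_ne (f x) (by rw [← hf, hx])
  obtain ⟨k, rfl⟩ : ∃ j, k = j + 1 := ⟨k - 1, by omega⟩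
  obtain ⟨w, hw⟩ : ∃ w : Cochain (OrbitSpace τ') (n + k), coboundary w =
    Cochain.pullback (orbitMap f' hf') (cupPow c (n + k + 1)) := h
  have hpow : ∀ n (σ : SingSimplex X n), Cochain.pullback (orbitMap f hf) (cupPow c n)
      ((orbitMk τ).comp σ) = alt (b ∘ f) (List.ofFn fun i => σ (stdSimplex.vertex i)) := by
    intro n σ
    refine (cupPow_eq_alt (orbitMk InfSph.antipode) c b hb2 n (f.comp σ)).trans ?_
    rw [alt_ofFn, alt_ofFn]
    rfl
  obtain ⟨M, hM0, hM1, hM2⟩ := alt_eq_of_coboundary_eq (τ := τ) ((orbitMk τ').comp Ψ)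
    (fun p => b (f' (Ψ p)))
    (fun d x hd => (congrArg (orbitMk τ') (hΨ2 d x hd)).trans (orbitMk_apply_map τ' _))
    (fun d x => by rw [hΨ1, hf', hb1]) (fun d x hd => by rw [hΨ2 d x hd, hf', hb1]) hk w
    (fun s => by
      rw [hw]
      refine (cupPow_eq_alt (orbitMk InfSph.antipode) c b hb2 _ (f'.comp (Ψ.comp s))).trans ?_
      rw [alt_ofFn, alt_ofFn]
      rfl)
    (b ∘ f) (fun x => by simp only [Function.comp]; rw [hf, hb1])
  rcases n with _ | n
  · -- in degree zero the identity reads `1 = 0`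
    funext s
    obtain ⟨σ, rfl⟩ := exists_lift hτc hτ hfree s
    have := hM2 0 σ (by omega)
    rw [hpow 0 σ, this]
    simp [List.finRange_succ, listD, hM0, shuffleSum_nil_right, signSum_zero]
  · choose lift hlift using fun s : SingSimplex (OrbitSpace τ) n => exists_lift hτc hτ hfree s
    have hF1 : ∀ d x, ((orbitMk τ').comp Ψ) (-d, τ x) = ((orbitMk τ').comp Ψ) (d, x) :=
      fun d x => (congrArg (orbitMk τ') (hΨ1 d x)).trans (orbitMk_apply_map τ' _)
    let μ : SingSimplex X n → ZMod 2 := fun σ =>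
      transfer w ((orbitMk τ').comp Ψ) σ + M (List.ofFn fun i => σ (stdSimplex.vertex i))
    have hμ : ∀ σ, μ (lift ((orbitMk τ).comp σ)) = μ σ := by
      intro σ
      rcases lift_unique hτc hτ hfree _ _ (hlift ((orbitMk τ).comp σ)) with h | h
      · rw [h]
      · rw [h]
        refine congrArg₂ (· + ·) (transfer_map _ hτc hF1 w σ (by omega)) ?_
        rw [← hM1 (List.ofFn fun i => σ (stdSimplex.vertex i)), List.map_ofFn]
        rfl
    refine ⟨fun s => μ (lift s), ?_⟩
    funext s
    obtain ⟨σ, rfl⟩ := exists_lift hτc hτ hfree s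
    rw [hpow, hM2 (n + 1) σ (by omega), listD_eq_sum_transfer _ _ _ (by omega), listD_ofFn,
      ← Finset.sum_add_distrib]
    refine Finset.sum_congr rfl fun i _ => ?_
    refine (hμ (σ.restrict i.succAbove)).trans ?_
    simp only [μ, restrict_apply_vertex]
    rw [add_comm]

/-! ### Maps between `Hom`-complexes -/

lemma carrier_nonempty {V W : Type*} [Fintype W] (x : V → stdSimplex ℝ W) (v : V) :
    (carrier x v).Nonempty := by
  by_contra h
  have h0 : ∀ w, x v w = 0 := fun w => by
    by_contra hw
    exact h ⟨w, hw⟩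
  have := stdSimplex.sum_eq_one (x v)
  simp [h0] at this

lemma stdSimplex_map_apply_of_involutive {W : Type*} [Fintype W] {b : W → W}
    (hb : ∀ w, b (b w) = w) (s : stdSimplex ℝ W) (w : W) : stdSimplex.map b s w = s (b w) := by
  classical
  rw [stdSimplex.map_coe, FunOnFinite.linearMap_apply_apply, Finset.sum_eq_single (b w)]
  · intro i hi hne
    refine absurd ?_ hne
    rw [← (Finset.mem_filter.1 hi).2, hb]
  · intro h
    simp [hb] at h

section

variable {V W U : Type*} [Fintype W] [Fintype U] {G : SimpleGraph V} {G' : SimpleGraph W}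
  {H : SimpleGraph U}

lemma HomComplex.ext_coord {x y : HomComplex G G'} (h : ∀ v w, x.1 v w = y.1 v w) : x = y :=
  Subtype.ext (funext fun v => stdSimplex.ext (funext fun w => h v w))

lemma HomComplex.continuous_coord (v : V) (w : W) :
    Continuous fun x : HomComplex G G' => x.1 v w :=
  (continuous_apply w).comp (continuous_subtype_val.comp
    ((continuous_apply v).comp continuous_subtype_val))

lemma HomComplex.continuous_of_coord {A : Type*} [TopologicalSpace A] {f : A → HomComplex G G'}
    (h : ∀ v w, Continuous fun a => (f a).1 v w) : Continuous f :=
  Continuous.subtype_mk (f := fun a => (f a).1)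
    (continuous_pi fun v => Continuous.subtype_mk (f := fun a => ((f a).1 v).1)
      (continuous_pi fun w => h v w) fun a => ((f a).1 v).2) fun a => (f a).2

lemma HomComplex.continuous_precomp (a : G →g G) :
    Continuous (HomComplex.precomp a : HomComplex G G' → HomComplex G G') :=
  continuous_of_coord fun v w => continuous_coord (a v) w

/-- Vertices of `G'` with nonzero coordinates at adjacent vertices of `G` are adjacent. -/
lemma HomComplex.adj (x : HomComplex G G') {u v : V} (huv : G.Adj u v) {w w' : W}
    (hw : x.1 u w ≠ 0) (hw' : x.1 v w' ≠ 0) : G'.Adj w w' := by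
  classical
  choose g hg using x.2.1
  have := x.2.2 (fun z => if z = u then w else if z = v then w' else g z) (fun z => by
    by_cases h1 : z = u
    · rw [h1, if_pos rfl]; exact hw
    · by_cases h2 : z = v
      · rw [h2, if_neg huv.ne', if_pos rfl]; exact hw'
      · simpa [h1, h2] using hg z) u v huv
  simpa [huv.ne'] using this

lemma isMultiHom_of_adj {x : V → stdSimplex ℝ W}
    (h : ∀ u v w w', G.Adj u v → x u w ≠ 0 → x v w' ≠ 0 → G'.Adj w w') :
    IsMultiHom G G' (carrier x) :=
  ⟨carrier_nonempty x, fun _ hf _ _ huv => h _ _ _ _ huv (hf _) (hf _)⟩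

/-- The composition of `z ∈ Hom(G, G')` and `x ∈ Hom(G', H)`, as the composition of stochastic
matrices. -/
noncomputable def HomComplex.compose (z : HomComplex G G') (x : HomComplex G' H) :
    HomComplex G H :=
  ⟨fun v => ⟨fun u => ∑ w, z.1 v w * x.1 w u,
      fun u => Finset.sum_nonneg fun w _ =>
        mul_nonneg (stdSimplex.zero_le _ _) (stdSimplex.zero_le _ _), by
      rw [Finset.sum_comm]
      simp_rw [← Finset.mul_sum, stdSimplex.sum_eq_one, mul_one]
      exact stdSimplex.sum_eq_one _⟩, by
    refine isMultiHom_of_adj fun u v w w' huv hw hw' => ?_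
    obtain ⟨a, -, ha⟩ := Finset.exists_ne_zero_of_sum_ne_zero hw
    obtain ⟨a', -, ha'⟩ := Finset.exists_ne_zero_of_sum_ne_zero hw'
    exact x.adj (z.adj huv (left_ne_zero_of_mul ha) (left_ne_zero_of_mul ha'))
      (right_ne_zero_of_mul ha) (right_ne_zero_of_mul ha')⟩

lemma HomComplex.compose_apply (z : HomComplex G G') (x : HomComplex G' H) (v : V) (u : U) :
    (z.compose x).1 v u = ∑ w, z.1 v w * x.1 w u := rfl

lemma HomComplex.continuous_compose :
    Continuous fun p : HomComplex G G' × HomComplex G' H => p.1.compose p.2 := by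
  refine continuous_of_coord fun v u => ?_
  simp only [compose_apply]
  exact continuous_finsetSum _ fun w _ =>
    ((continuous_coord v w).comp continuous_fst).mul ((continuous_coord w u).comp continuous_snd)

lemma HomComplex.postcomp_apply (β : GraphInvolution G') (z : HomComplex G G') (v : V) (w : W) :
    (z.postcomp β.toHom).1 v w = z.1 v (β.toHom w) :=
  stdSimplex_map_apply_of_involutive β.invol _ _

lemma HomComplex.continuous_postcomp (β : GraphInvolution G') :
    Continuous (HomComplex.postcomp β.toHom : HomComplex G G' → HomComplex G G') := by
  refine continuous_of_coord fun v w => ?_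
  simp only [postcomp_apply]
  exact continuous_coord _ _

lemma HomComplex.postcomp_compose (β : GraphInvolution G') (z : HomComplex G G')
    (x : HomComplex G' H) :
    (z.postcomp β.toHom).compose x = z.compose (x.precomp β.toHom) := by
  refine ext_coord fun v u => ?_
  simp only [compose_apply, postcomp_apply]
  refine Fintype.sum_bijective β.toHom (Function.Involutive.bijective β.invol) _ _ fun w => ?_
  change _ = _ * x.1 (β.toHom (β.toHom w)) u
  rw [β.invol]

lemma HomComplex.precomp_precomp (α : GraphInvolution G) (x : HomComplex G G') :
    (x.precomp α.toHom).precomp α.toHom = x := by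
  refine ext_coord fun v w => ?_
  change x.1 (α.toHom (α.toHom v)) w = _
  rw [α.invol]

/-- The involution `z ↦ α ∗ z ∗ β`, whose fixed points form `Hom_{ℤ₂}(G, G')`. -/
noncomputable def conjugation (α : GraphInvolution G) (β : GraphInvolution G')
    (z : HomComplex G G') : HomComplex G G' :=
  (z.postcomp β.toHom).precomp α.toHom

lemma conjugation_apply (α : GraphInvolution G) (β : GraphInvolution G') (z : HomComplex G G')
    (v : V) (w : W) : (conjugation α β z).1 v w = z.1 (α.toHom v) (β.toHom w) :=
  HomComplex.postcomp_apply β z (α.toHom v) w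

lemma conjugation_conjugation (α : GraphInvolution G) (β : GraphInvolution G')
    (z : HomComplex G G') : conjugation α β (conjugation α β z) = z :=
  HomComplex.ext_coord fun v w => by simp only [conjugation_apply, α.invol, β.invol]

lemma conjugation_compose (α : GraphInvolution G) (β : GraphInvolution G') (z : HomComplex G G')
    (x : HomComplex G' H) :
    (conjugation α β z).compose x = (z.compose (x.precomp β.toHom)).precomp α.toHom := by
  rw [← HomComplex.postcomp_compose]
  rfl

end

section orbits

variable {V W : Type*} {G : SimpleGraph V} {G' : SimpleGraph W}

/-- The orbit of a vertex. -/
def GraphInvolution.orbit (β : GraphInvolution G') (w : W) : β.Orbit := ⟨{w, β.toHom w}, w, rfl⟩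

lemma GraphInvolution.orbit_map (β : GraphInvolution G') (w : W) :
    β.orbit (β.toHom w) = β.orbit w :=
  Subtype.ext (by simp [orbit, β.invol, Set.pair_comm])

lemma GraphInvolution.adj_of_orbit_adj (β : GraphInvolution G') {w w' : W}
    (h : β.fixedGraph.Adj (β.orbit w) (β.orbit w')) : G'.Adj w w' := by
  obtain ⟨u, v, hu, hv, h1, h2⟩ := h
  have hw : w ∈ ({u, β.toHom u} : Set W) := by rw [← hu]; simp [orbit]
  have hw' : w' ∈ ({v, β.toHom v} : Set W) := by rw [← hv]; simp [orbit]
  have h3 := β.toHom.map_adj h1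
  have h4 := β.toHom.map_adj h2
  rw [β.invol] at h4
  rcases hw with rfl | rfl <;> rcases hw' with rfl | rfl <;> assumption

variable [Fintype W]

open Classical in
/-- The map `Hom(G, G'^{ℤ₂}) → Hom(G, G')` that replaces an orbit by its barycentre. -/
noncomputable def orbitBarycentre (β : GraphInvolution G') (y : HomComplex G β.fixedGraph) :
    HomComplex G G' :=
  ⟨fun v => ⟨fun w => y.1 v (β.orbit w) /
        (Finset.univ.filter fun w' => β.orbit w' = β.orbit w).card,
      fun w => div_nonneg (stdSimplex.zero_le _ _) (Nat.cast_nonneg _), by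
      rw [← stdSimplex.sum_eq_one (y.1 v), ← Finset.sum_fiberwise Finset.univ β.orbit]
      refine Finset.sum_congr rfl fun O _ => ?_
      have hO : (Finset.univ.filter fun w' => β.orbit w' = O).Nonempty := by
        obtain ⟨u, hu⟩ := O.2
        exact ⟨u, Finset.mem_filter.2 ⟨Finset.mem_univ _, Subtype.ext hu.symm⟩⟩
      rw [Finset.sum_congr rfl (g := fun _ => y.1 v O /
        (Finset.univ.filter fun w' => β.orbit w' = O).card) fun w hw => by
          rw [(Finset.mem_filter.1 hw).2], Finset.sum_const, nsmul_eq_mul]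
      exact mul_div_cancel₀ _ (Nat.cast_ne_zero.2 hO.card_ne_zero)⟩,
    isMultiHom_of_adj fun u v w w' huv hw hw' => β.adj_of_orbit_adj
      (y.adj huv (fun h => hw (div_eq_zero_iff.2 (.inl h)))
      (fun h => hw' (div_eq_zero_iff.2 (.inl h))))⟩

open Classical in
lemma orbitBarycentre_apply (β : GraphInvolution G') (y : HomComplex G β.fixedGraph) (v : V)
    (w : W) : (orbitBarycentre β y).1 v w =
      y.1 v (β.orbit w) / (Finset.univ.filter fun w' => β.orbit w' = β.orbit w).card := rfl

lemma continuous_orbitBarycentre (β : GraphInvolution G') :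
    Continuous (orbitBarycentre β : HomComplex G β.fixedGraph → _) := by
  refine HomComplex.continuous_of_coord fun v w => ?_
  simp only [orbitBarycentre_apply]
  exact (HomComplex.continuous_coord _ _).div_const _

lemma postcomp_orbitBarycentre (β : GraphInvolution G') (y : HomComplex G β.fixedGraph) :
    (orbitBarycentre β y).postcomp β.toHom = orbitBarycentre β y := by
  refine HomComplex.ext_coord fun v w => ?_
  rw [HomComplex.postcomp_apply, orbitBarycentre_apply, orbitBarycentre_apply, β.orbit_map]

lemma orbitBarycentre_precomp (α : GraphInvolution G) (β : GraphInvolution G')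
    (y : HomComplex G β.fixedGraph) :
    orbitBarycentre β (y.precomp α.toHom) = (orbitBarycentre β y).precomp α.toHom := rfl

end orbits

/-- The normalisation of a nowhere vanishing vector valued function. -/
lemma exists_map_infSph {A U : Type*} [TopologicalSpace A] [Fintype U] (D : A → U → ℝ)
    (hD : ∀ u, Continuous fun a => D a u) (hne : ∀ a, ∃ u, D a u ≠ 0) :
    ∃ f : C(A, InfSph), ∀ a a', (∀ u, D a' u = -D a u) → f a' = InfSph.antipode (f a) := by
  let e := Fintype.equivFin U
  let v : A → ℕ → ℝ := fun a i => if h : i < Fintype.card U then D a (e.symm ⟨i, h⟩) else 0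
  have hpos : ∀ a, 0 < ∑ u, D a u ^ 2 := fun a => by
    obtain ⟨u, hu⟩ := hne a
    exact Finset.sum_pos' (fun _ _ => sq_nonneg _) ⟨u, Finset.mem_univ _, by positivity⟩
  have hsum : ∀ a, ∑ i ∈ Finset.range (Fintype.card U + 1), v a i ^ 2 = ∑ u, D a u ^ 2 := by
    intro a
    rw [Finset.sum_range_succ, Finset.sum_range, ← e.symm.sum_comp]
    simp [v]
  refine ⟨⟨fun a => ⟨fun i => v a i / √(∑ u, D a u ^ 2), Fintype.card U, fun i hi => by
      simp [v, hi.not_gt], by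
      simp only [div_pow, Real.sq_sqrt (hpos a).le, ← Finset.sum_div, hsum]
      exact div_self (hpos a).ne'⟩, ?_⟩, fun a a' h => Subtype.ext (funext fun i => ?_)⟩
  · refine InfSph.continuous_of_coord _ (Fintype.card U) (fun a i hi => ?_) fun i => ?_
    · change v a i / _ = 0
      simp [v, hi.not_gt]
    · change Continuous fun a => v a i / √(∑ u, D a u ^ 2)
      refine Continuous.div ?_ (by fun_prop) fun a => (Real.sqrt_pos.2 (hpos a)).ne'
      by_cases h : i < Fintype.card U
      · simpa only [v, dif_pos h] using hD _
      · simpa only [v, dif_neg h] using continuous_const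
  · change v a' i / √(∑ u, D a' u ^ 2) = -(v a i / √(∑ u, D a u ^ 2))
    simp only [h, even_two.neg_pow, v, ← neg_div]
    split_ifs <;> simp

/-- If the involution of `G` flips an edge, then `Hom(G, H)` maps to the infinite sphere: the
difference of the coordinates at the ends of that edge does not vanish. -/
lemma GraphInvolution.FlipsEdge.exists_map_infSph {V U : Type*} [Fintype U] {G : SimpleGraph V}
    {α : GraphInvolution G} (hα : α.FlipsEdge) (H : SimpleGraph U) :
    ∃ f : C(HomComplex G H, InfSph), IsZ2Map (HomComplex.precomp α.toHom) InfSph.antipode f := by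
  obtain ⟨a, b, hab, h1, h2⟩ := hα
  obtain ⟨f, hf⟩ := HomIndex.exists_map_infSph (fun (x : HomComplex G H) u => x.1 a u - x.1 b u)
    (fun u => (HomComplex.continuous_coord a u).sub (HomComplex.continuous_coord b u)) (by
      intro x
      obtain ⟨u, hu⟩ := carrier_nonempty x.1 a
      refine ⟨u, fun h => H.irrefl (x.adj hab hu (w' := u) ?_)⟩
      rw [← sub_eq_zero.1 h]
      exact hu)
  refine ⟨f, fun x => hf _ _ fun u => ?_⟩
  change x.1 (α.toHom a) u - x.1 (α.toHom b) u = _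
  rw [h1, h2]
  ring

/-! ### The index inequality -/

lemma exists_sph_incl {j m : ℕ} (h : j ≤ m) :
    ∃ i : C(Sph j, Sph m), IsZ2Map (antipode j) (antipode m) i := by
  induction m, h using Nat.le_induction with
  | base => exact ⟨ContinuousMap.id _, fun _ => rfl⟩
  | succ m _ ih =>
    obtain ⟨i, hi⟩ := ih
    have hmem : ∀ x, consZero (i x).1 ∈ Metric.sphere 0 1 := fun x => by simp [norm_consZero]
    refine ⟨⟨fun x => ⟨consZero (i x).1, hmem x⟩,
      Continuous.subtype_mk (continuous_consZero.comp (by fun_prop)) hmem⟩, fun x => ?_⟩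
    refine Subtype.ext ?_
    change consZero (i (antipode j x)).1 = -consZero (i x).1
    rw [hi, ← consZero_neg]
    rfl

lemma exists_of_le_coind {X : Type*} [TopologicalSpace X] {τ : X → X} {j : ℕ}
    (h : ((j : ℕ∞) : WithBot ℕ∞) ≤ coind τ) :
    ∃ f : C(Sph j, X), IsZ2Map (antipode j) τ f := by
  obtain ⟨m, hjm, f, hf⟩ : ∃ m, j ≤ m ∧ ∃ f : C(Sph m, X), IsZ2Map (antipode m) τ f := by
    by_contra! hcon
    have hlt : coind τ < ((j : ℕ∞) : WithBot ℕ∞) := by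
      rcases j with _ | j
      · refine (sSup_le (a := ⊥) ?_).trans_lt (WithBot.bot_lt_coe _)
        rintro _ ⟨m, rfl, f, hf⟩
        exact absurd hf (hcon m (Nat.zero_le _) f)
      · refine (sSup_le (a := ((j : ℕ∞) : WithBot ℕ∞)) ?_).trans_lt
          (by exact_mod_cast j.lt_succ_self)
        rintro _ ⟨m, rfl, f, hf⟩
        by_contra hm
        refine hcon m ?_ f hf
        have : j < m := by exact_mod_cast not_le.1 hm
        omega
    exact absurd h hlt.not_ge
  obtain ⟨i, hi⟩ := exists_sph_incl hjm
  exact ⟨f.comp i, fun x => by simp only [ContinuousMap.comp_apply]; rw [hi, hf]⟩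

lemma sSup_add_le {S : Set (WithBot ℕ∞)} (k : ℕ) (B : WithBot ℕ∞)
    (hS : ∀ m ∈ S, ∃ n : ℕ, m = ((n : ℕ∞) : WithBot ℕ∞))
    (h : ∀ n : ℕ, ((n : ℕ∞) : WithBot ℕ∞) ∈ S → (((n + k : ℕ) : ℕ∞) : WithBot ℕ∞) ≤ B) :
    sSup S + ((k : ℕ∞) : WithBot ℕ∞) ≤ B := by
  rcases S.eq_empty_or_nonempty with rfl | ⟨m, hm⟩
  · simp
  obtain ⟨n, rfl⟩ := hS m hm
  have hB := h n hm
  induction B using WithBot.recBotCoe with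
  | bot => simp at hB
  | coe B =>
    induction B using ENat.recTopCoe with
    | top => exact le_top
    | coe B =>
      have hn : n + k ≤ B := by exact_mod_cast hB
      have hle : sSup S ≤ (((B - k : ℕ) : ℕ∞) : WithBot ℕ∞) := by
        refine sSup_le fun m' hm' => ?_
        obtain ⟨n', rfl⟩ := hS m' hm'
        have h' : n' + k ≤ B := by exact_mod_cast h n' hm'
        have : n' ≤ B - k := by omega
        exact_mod_cast this
      calc sSup S + ((k : ℕ∞) : WithBot ℕ∞)
          ≤ (((B - k : ℕ) : ℕ∞) : WithBot ℕ∞) + ((k : ℕ∞) : WithBot ℕ∞) := by gcongr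
        _ = (((B - k + k : ℕ) : ℕ∞) : WithBot ℕ∞) := by push_cast; rfl
        _ ≤ _ := by rw [Nat.sub_add_cancel (by omega)]

/-- The radial map `ℝᵏ → Dᵏ` that sends the complement of the cross-polytope to the sphere. -/
noncomputable def radial {k : ℕ} (d : EuclideanSpace ℝ (Fin k)) : EuclideanSpace ℝ (Fin k) :=
  (max 1 ‖(k : ℝ) • d‖)⁻¹ • ((k : ℝ) • d)

lemma continuous_radial {k : ℕ} : Continuous (radial (k := k)) := by
  unfold radial
  have h1 : Continuous fun d : EuclideanSpace ℝ (Fin k) => (k : ℝ) • d := by fun_prop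
  have h2 : Continuous fun d : EuclideanSpace ℝ (Fin k) => max 1 ‖(k : ℝ) • d‖ := by fun_prop
  exact (h2.inv₀ fun d => (zero_lt_one.trans_le (le_max_left _ _)).ne').smul h1

lemma radial_neg {k : ℕ} (d : EuclideanSpace ℝ (Fin k)) : radial (-d) = -radial d := by
  simp [radial]

lemma norm_radial {k : ℕ} (d : EuclideanSpace ℝ (Fin k)) :
    ‖radial d‖ = (max 1 ‖(k : ℝ) • d‖)⁻¹ * ‖(k : ℝ) • d‖ := by
  have : 0 < max 1 ‖(k : ℝ) • d‖ := zero_lt_one.trans_le (le_max_left _ _)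
  rw [radial, norm_smul, norm_inv, Real.norm_of_nonneg this.le]

lemma radial_mem_closedBall {k : ℕ} (d : EuclideanSpace ℝ (Fin k)) :
    radial d ∈ Metric.closedBall 0 1 := by
  have : 0 < max 1 ‖(k : ℝ) • d‖ := zero_lt_one.trans_le (le_max_left _ _)
  rw [mem_closedBall_zero_iff, norm_radial, inv_mul_le_iff₀ this, mul_one]
  exact le_max_right _ _

lemma radial_mem_sphere {k : ℕ} (d : EuclideanSpace ℝ (Fin k)) (h : 1 ≤ ∑ j, |d j|) :
    radial d ∈ Metric.sphere 0 1 := by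
  have h1 : 1 ≤ ‖(k : ℝ) • d‖ := by
    refine h.trans ((Finset.sum_le_sum fun j _ => ?_).trans_eq
      (b := ∑ _j : Fin k, ‖d‖) ?_)
    · exact PiLp.norm_apply_le d j
    · simp [norm_smul]
  rw [mem_sphere_zero_iff_norm, norm_radial, max_eq_right h1]
  exact inv_mul_cancel₀ (zero_lt_one.trans_le h1).ne'

lemma mem_homEquivariant_iff {V W : Type*} [Fintype W] {G : SimpleGraph V} {G' : SimpleGraph W}
    {α : GraphInvolution G} {β : GraphInvolution G'} {z : HomComplex G G'} :
    z ∈ HomEquivariant α β ↔ conjugation α β z = z := by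
  constructor
  · intro h
    have h : z.precomp α.toHom = z.postcomp β.toHom := h
    rw [conjugation, ← h, HomComplex.precomp_precomp]
  · intro h
    change z.precomp α.toHom = z.postcomp β.toHom
    conv_lhs => rw [← h]
    rw [conjugation, HomComplex.precomp_precomp]

/-- A family of points of `Hom(G, G')`, indexed by `ℝᵏ`, that is equivariant for the involution
`z ↦ α ∗ z ∗ β` and consists of `β`-invariant points outside of the cross-polytope. -/
lemma exists_family {V W : Type*} [Fintype W] {G : SimpleGraph V} {G' : SimpleGraph W}
    {α : GraphInvolution G} {β : GraphInvolution G'} {k : ℕ} (hk : 1 ≤ k)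
    (hcoind : (((k - 1 : ℕ) : ℕ∞) : WithBot ℕ∞) ≤
      coind (HomComplex.precomp (H := β.fixedGraph) α.toHom))
    (hequiv : (HomEquivariant α β).Nonempty) (hconn : IsConn (HomComplex G G') ((k : ℤ) - 1)) :
    ∃ g : C(EuclideanSpace ℝ (Fin k), HomComplex G G'),
      (∀ d, g (-d) = conjugation α β (g d)) ∧
      ∀ d, 1 ≤ ∑ j, |d j| → (g d).postcomp β.toHom = g d := by
  obtain ⟨k, rfl⟩ : ∃ j, k = j + 1 := ⟨k - 1, by omega⟩
  obtain ⟨f, hf⟩ := exists_of_le_coind hcoind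
  obtain ⟨z₀, hz₀⟩ := hequiv
  classical
  let F : EuclideanSpace ℝ (Fin (k + 1)) → HomComplex G G' := fun x =>
    if hx : x ∈ Metric.sphere 0 1 then orbitBarycentre β (f ⟨x, hx⟩) else z₀
  have hF : ∀ x (hx : x ∈ Metric.sphere 0 1), F x = orbitBarycentre β (f ⟨x, hx⟩) :=
    fun x hx => dif_pos hx
  have hFpost : ∀ x ∈ Metric.sphere 0 1, (F x).postcomp β.toHom = F x := fun x hx => by
    rw [hF x hx, postcomp_orbitBarycentre]
  obtain ⟨g, hg, hgodd, hgF⟩ := hconn.exists_odd_extend (conjugation α β)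
    ((HomComplex.continuous_precomp _).comp (HomComplex.continuous_postcomp β))
    (conjugation_conjugation α β) z₀ (mem_homEquivariant_iff.1 hz₀) (k + 1) (by omega) F
    (by
      rw [continuousOn_iff_continuous_domRestrict]
      refine ((continuous_orbitBarycentre β).comp f.continuous).congr fun x => ?_
      exact (hF x.1 x.2).symm)
    (fun x hx => by
      have hx' : -x ∈ Metric.sphere 0 1 := by simpa using hx
      rw [conjugation, hFpost x hx, hF _ hx', hF _ hx, ← orbitBarycentre_precomp, ← hf]
      rfl)
  refine ⟨⟨fun d => g (radial d), hg.comp_continuous continuous_radial radial_mem_closedBall⟩,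
    fun d => ?_, fun d hd => ?_⟩
  · change g (radial (-d)) = conjugation α β (g (radial d))
    rw [radial_neg, hgodd _ (radial_mem_closedBall d)]
  · change (g (radial d)).postcomp β.toHom = g (radial d)
    have h := radial_mem_sphere d hd
    rw [hgF h, hFpost _ h]

end HomIndex

theorem mainTheorem4 {V : Type*} {V' : Type*} [Fintype V] [Fintype V']
    (G : SimpleGraph V) (G' : SimpleGraph V')
    (α : HomIndex.GraphInvolution G) (β : HomIndex.GraphInvolution G')
    (hα : α.FlipsEdge) (k : ℕ) (hk : 1 ≤ k)
    (hcoind : (((k - 1 : ℕ) : ℕ∞) : WithBot ℕ∞) ≤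
      HomIndex.coind (HomIndex.HomComplex.precomp (H := β.fixedGraph) α.toHom))
    (hequiv : (HomIndex.HomEquivariant α β).Nonempty)
    (hconn : HomIndex.IsConn (HomIndex.HomComplex G G') ((k : ℤ) - 1)) :
    ∀ {U : Type*} [Fintype U] (H : SimpleGraph U), Nonempty (HomIndex.HomComplex G' H) →
      HomIndex.hind (HomIndex.HomComplex.precomp (H := H) β.toHom) +
          ((k : ℕ∞) : WithBot ℕ∞) ≤
        HomIndex.hind (HomIndex.HomComplex.precomp (H := H) α.toHom) := by
  intro U _ H _
  obtain ⟨g, hg1, hg2⟩ := HomIndex.exists_family hk hcoind hequiv hconn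
  obtain ⟨f', hf'⟩ := hα.exists_map_infSph H
  refine HomIndex.sSup_add_le k _ (fun m hm => ⟨hm.choose, hm.choose_spec.1⟩) ?_
  rintro n ⟨n', hn', f, hf, c, hc, hne⟩
  obtain rfl : n = n' := by exact_mod_cast hn'
  refine le_sSup ⟨n + k, rfl, f', hf', c, hc, fun h => hne ?_⟩
  let Ψ : C(EuclideanSpace ℝ (Fin k) × HomIndex.HomComplex G' H, HomIndex.HomComplex G H) :=
    ⟨fun p => (g p.1).compose p.2, HomIndex.HomComplex.continuous_compose.comp
      ((g.continuous.comp continuous_fst).prodMk continuous_snd)⟩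
  refine HomIndex.isCoboundary_of_map (HomIndex.HomComplex.continuous_precomp _)
    (HomIndex.HomComplex.precomp_precomp β) hk Ψ (fun d x => ?_) (fun d x hd => ?_) f hf f' hf' hc
    n h
  · change (g (-d)).compose (x.precomp β.toHom) = ((g d).compose x).precomp α.toHom
    rw [hg1, HomIndex.conjugation_compose, HomIndex.HomComplex.precomp_precomp]
  · change (g (-d)).compose x = ((g d).compose x).precomp α.toHom
    rw [hg1, HomIndex.conjugation_compose, ← HomIndex.HomComplex.postcomp_compose, hg2 d hd]
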